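/- Let $\Omega\subset\mathbb R^3$ be a bounded domain with boundary of class $C^2$, let $T>0$, $k>0$, and let $\mathcal S$ be the space of symmetric real $3\times3$ matrices with $A:B=\sum_{i,j}A_{ij}B_{ij}$ and $|A|=(A:A)^{1/2}$. Let $\mathbb D:\mathcal S\to\mathcal S$ be linear, symmetric and positive definite, and let $P A=A-\tfrac13\operatorname{tr}(A)\,\mathrm{id}$. Let $f:\mathbb R\to\mathbb R$ be continuous with $|f(r)|\le a+M|r|^{\alpha}$ for all $r\in\mathbb R$, for some $a,M\ge0$ and $\alpha\in(\tfrac12,\tfrac56)$, and $|f(r)|\le C_0(1+|r|)^{1/2}$ for all $r<0$, for some $C_0>0$. Let $F\in L^2(0,T;L^2(\Omega;\mathbb R^3))$, $g_\theta\in H^1(0,T;L^2(\partial\Omega))$, $u_0\in H^1(\Omega;\mathbb R^3)$, $\varepsilon^{p,0}\in L^2(\Omega;\mathcal S)$, $\theta_0\in H^1(\Omega)$, and assume $$|P\,\mathbb D(\varepsilon(u_0)-\varepsilon^{p,0})|\le k\quad\text{a.e. in }\Omega,\qquad \varepsilon(u)=\tfrac12(\nabla u+\nabla^{T}u).$$ Let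 $\tilde\theta\in L^\infty(0,T;H^1(\Omega))$, $\tilde\theta_t\in L^2(0,T;L^2(\Omega))$, be the weak solution of $\tilde\theta_t-\Delta\tilde\theta=0$ in $\Omega\times(0,T)$, $\partial\tilde\theta/\partial n=g_\theta$ on $\partial\Omega\times(0,T)$, $\tilde\theta(0)=0$. For $\lambda>0$ put $\mathcal T_{1/\lambda}(r)=\min\{1/\lambda,\max(r,-1/\lambda)\}$ and $$Y_\lambda(A)=\frac{(|PA|-k)_+}{2\lambda}\,\frac{PA}{|PA|}\qquad(Y_\lambda(A)=0\text{ if }PA=0),$$ and let $(u^\lambda,\mathbb T^\lambda,\varepsilon^{p,\lambda},\theta^\lambda)$ with $u^\lambda\in H^1(0,T;H^1_0(\Omega;\mathbb R^3))$, $\varepsilon^{p,\lambda}\in H^1(0,T;L^2(\Omega;\mathcal S))$, $\theta^\lambda\in L^2(0,T;H^1(\Omega))\cap H^1(0,T;L^2(\Omega))$ be a solution of $$\begin{aligned} \operatorname{div}\sigma^\lambda&=-F-\operatorname{div}\mathbb D(\varepsilon(u^\lambda_t)),\\ \sigma^\lambda&=\mathbb D(\varepsilon(u^\lambda)-\varepsilon^{p,\lambda})-f\big(\mathcal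 T_{1/\lambda}(\theta^\lambda+\tilde\theta)\big)\,\mathrm{id},\\ \varepsilon^{p,\lambda}_t&=Y_\lambda(\mathbb T^\lambda),\qquad \mathbb T^\lambda=\mathbb D(\varepsilon(u^\lambda)-\varepsilon^{p,\lambda}),\\ \theta^\lambda_t-\Delta\theta^\lambda&=-f\big(\mathcal T_{1/\lambda}(\theta^\lambda+\tilde\theta)\big)\operatorname{div}u^\lambda_t+\mathcal T_{1/\lambda}\big(\varepsilon^{p,\lambda}_t:\mathbb T^\lambda\big) \end{aligned}$$ in $\Omega\times(0,T)$, with $u^\lambda=0$ and $\partial\theta^\lambda/\partial n=0$ on $\partial\Omega$ and $u^\lambda(0)=u_0$, $\varepsilon^{p,\lambda}(0)=\varepsilon^{p,0}$, $\theta^\lambda(0)=\theta_0$ (the first equation in the sense of distributions on $\Omega$ for a.e. $t$; the heat equation with its Neumann condition in the weak sense with test functions in $H^1(\Omega)$ for a.e. $t$; the others a.e.). Then the family $\{\mathbb T^\lambda_t\}_{\lambda>0}$ is bounded in $L^2(0,T;L^2(\Omega;\mathcal S))$ uniformly in $\lambda$: there is a constant $C$, depending on the data above but neither on $\lambda$ nor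 on the solution, such that for every $\lambda>0$ and every such solution the weak time derivative $\mathbb T^\lambda_t$ exists, belongs to $L^2(0,T;L^2(\Omega;\mathcal S))$, and satisfies $$\|\mathbb T^\lambda_t\|_{L^2(0,T;L^2(\Omega;\mathcal S))}\le C .$$ -/

import Mathlib

open MeasureTheory Set Filter Topology
open scoped ENNReal NNReal Distributions Gradient

noncomputable section

namespace ThermoPlast

/-- The space `ℝ³` with its Euclidean structure. -/
abbrev R3 : Type := EuclideanSpace ℝ (Fin 3)

/-- Real `3 × 3` matrices, with the Frobenius inner product `A : B = ∑ i j, A i j * B i j`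
(written `inner ℝ A B`) and the Frobenius norm. The entry `A i j` is `A (i, j)`. -/
abbrev Mat3 : Type := EuclideanSpace ℝ (Fin 3 × Fin 3)

/-- The space `𝒮` of symmetric `3 × 3` matrices, a subspace of `Mat3`. -/
def Sym3 : Submodule ℝ Mat3 where
  carrier := {A | ∀ i j, A (i, j) = A (j, i)}
  add_mem' := by
    intro A B hA hB i j
    simp [hA i j, hB i j]
  zero_mem' := by
    intro i j
    simp
  smul_mem' := by
    intro c A hA i j
    simp [hA i j]

/-- The identity matrix. -/
def idMat : Sym3 :=
  ⟨WithLp.toLp 2 fun p => if p.1 = p.2 then 1 else 0, by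
    intro i j
    simp [eq_comm]⟩

/-- The trace of a matrix. -/
def tr (A : Mat3) : ℝ := ∑ i, A (i, i)

/-- The symmetric part `(A + Aᵀ) / 2`. -/
def symPart (A : Mat3) : Sym3 :=
  ⟨WithLp.toLp 2 fun p => (A (p.1, p.2) + A (p.2, p.1)) / 2, by
    intro i j
    simp [add_comm]⟩

/-- The projector on the deviatoric part, `P A = A - (tr A / 3) id`. -/
def dev (A : Sym3) : Sym3 := A - (tr (A : Mat3) / 3) • idMat

/-- The Yosida approximation
`Y_λ(A) = (|P A| - k)₊ / (2 λ) * (P A / |P A|)`, with the value `0` where `P A = 0`. -/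
def yosida (lam k : ℝ) (A : Sym3) : Sym3 :=
  (max 0 (‖dev A‖ - k) / (2 * lam)) • (‖dev A‖⁻¹ • dev A)

/-- Truncation at height `K`. -/
def trunc (K r : ℝ) : ℝ := min K (max r (-K))

/-! ### Sobolev functions on an open set -/

/-- Lebesgue measure on `Ω`. -/
abbrev spaceMeasure (Ω : TopologicalSpace.Opens R3) : Measure R3 := volume.restrict (Ω : Set R3)

/-- Lebesgue measure on `(0, T)`. -/
abbrev timeMeasure (T : ℝ) : Measure ℝ := volume.restrict (Ioo 0 T)

/-- The partial derivative `∂_j φ (x)` of a scalar function. -/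
def partialDeriv (j : Fin 3) (φ : R3 → ℝ) (x : R3) : ℝ :=
  fderiv ℝ φ x (EuclideanSpace.single j 1)

/-- The Jacobian matrix of a vector field: the entry `(i, j)` is `∂_j φ_i`. -/
def jacobian (φ : R3 → R3) (x : R3) : Mat3 :=
  WithLp.toLp 2 fun p => fderiv ℝ φ x (EuclideanSpace.single p.2 1) p.1

/-- `G` is the weak gradient of `w` on `Ω`. -/
def HasWeakGradient (Ω : TopologicalSpace.Opens R3) (w : R3 → ℝ) (G : R3 → R3) : Prop :=
  ∀ φ : 𝓓(Ω, ℝ), ∀ j : Fin 3,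
    ∫ x in (Ω : Set R3), w x * partialDeriv j φ x = -∫ x in (Ω : Set R3), G x j * φ x

/-- `w ∈ H¹(Ω; ℝ)`, with weak gradient `G`. -/
structure InH1 (Ω : TopologicalSpace.Opens R3) (w : R3 → ℝ) (G : R3 → R3) : Prop where
  memLp : MemLp w 2 (spaceMeasure Ω)
  grad_memLp : MemLp G 2 (spaceMeasure Ω)
  weakGradient : HasWeakGradient Ω w G

/-- `w ∈ H¹(Ω; ℝ³)`, with weak Jacobian `G`. -/
structure InH1Vec (Ω : TopologicalSpace.Opens R3) (w : R3 → R3) (G : R3 → Mat3) : Prop where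
  memLp : MemLp w 2 (spaceMeasure Ω)
  grad_memLp : MemLp G 2 (spaceMeasure Ω)
  weakGradient : ∀ i : Fin 3,
    HasWeakGradient Ω (fun x => w x i) (fun x => WithLp.toLp 2 fun j => G x (i, j))

/-- `w ∈ H¹₀(Ω; ℝ³)`, with weak Jacobian `G`: the pair `(w, G)` is a limit in `L²` of pairs
`(φ, ∇φ)` with `φ ∈ C_c^∞(Ω; ℝ³)`. -/
structure InH10Vec (Ω : TopologicalSpace.Opens R3) (w : R3 → R3) (G : R3 → Mat3) : Prop where
  memLp : MemLp w 2 (spaceMeasure Ω)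
  grad_memLp : MemLp G 2 (spaceMeasure Ω)
  approx : ∃ φ : ℕ → 𝓓(Ω, R3),
    Tendsto (fun n => eLpNorm (fun x => w x - φ n x) 2 (spaceMeasure Ω)) atTop (𝓝 0) ∧
    Tendsto (fun n => eLpNorm (fun x => G x - jacobian (φ n) x) 2 (spaceMeasure Ω)) atTop (𝓝 0)

/-! ### Functions of time and space -/

section Time

variable {X V : Type*} [MeasurableSpace X] [NormedAddCommGroup V] [NormedSpace ℝ V]

/-- `w ∈ L²(0, T; L²(X, μ; V))`. -/
def MemL2L2 (μ : Measure X) (T : ℝ) (w : ℝ → X → V) : Prop :=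
  MemLp (fun p : ℝ × X => w p.1 p.2) 2 ((timeMeasure T).prod μ)

/-- The norm of `L²(0, T; L²(X, μ; V))`. -/
def normL2L2 (μ : Measure X) (T : ℝ) (w : ℝ → X → V) : ℝ≥0∞ :=
  eLpNorm (fun p : ℝ × X => w p.1 p.2) 2 ((timeMeasure T).prod μ)

/-- `wt` is the weak time derivative of `w` on `(0, T)`. (The exceptional set of `x` can be taken
independent of `φ`, since there is a countable dense set of test functions.) -/
def HasWeakTimeDeriv (μ : Measure X) (T : ℝ) (w wt : ℝ → X → V) : Prop :=
  ∀ᵐ x ∂μ, ∀ φ : 𝓓((⟨Ioo 0 T, isOpen_Ioo⟩ : TopologicalSpace.Opens ℝ), ℝ),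
    ∫ t in Ioo 0 T, deriv φ t • w t x = -∫ t in Ioo 0 T, φ t • wt t x

/-- `wt` is the weak time derivative of `w` on `(0, T)` and `w(0) = w₀`: the test functions
vanish near `T` but not necessarily near `0`. -/
def HasWeakTimeDerivFrom (μ : Measure X) (T : ℝ) (w wt : ℝ → X → V) (w₀ : X → V) : Prop :=
  ∀ᵐ x ∂μ, ∀ φ : 𝓓((⟨Iio T, isOpen_Iio⟩ : TopologicalSpace.Opens ℝ), ℝ),
    ∫ t in Ioo 0 T, deriv φ t • w t x = -(φ 0 • w₀ x) - ∫ t in Ioo 0 T, φ t • wt t x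

/-- `w ∈ H¹(0, T; L²(X, μ; V))`, with time derivative `wt`. -/
structure InH1Time (μ : Measure X) (T : ℝ) (w wt : ℝ → X → V) : Prop where
  memL2 : MemL2L2 μ T w
  deriv_memL2 : MemL2L2 μ T wt
  weakDeriv : HasWeakTimeDeriv μ T w wt

/-- `w ∈ H¹(0, T; L²(X, μ; V))`, with time derivative `wt` and initial value `w₀`. -/
structure InH1TimeFrom (μ : Measure X) (T : ℝ) (w wt : ℝ → X → V) (w₀ : X → V) : Prop where
  memL2 : MemL2L2 μ T w
  deriv_memL2 : MemL2L2 μ T wt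
  weakDeriv : HasWeakTimeDerivFrom μ T w wt w₀

end Time

/-! ### The domain and the boundary data -/

/-- `Ω` is a bounded domain with boundary of class `C²`: near each boundary point, `Ω` is a
strict sublevel set of a `C²` function without critical points. -/
structure IsBoundedC2Domain (Ω : TopologicalSpace.Opens R3) : Prop where
  connected : IsConnected (Ω : Set R3)
  bounded : Bornology.IsBounded (Ω : Set R3)
  boundary : ∀ x ∈ frontier (Ω : Set R3), ∃ (U : Set R3) (ψ : R3 → ℝ),
    IsOpen U ∧ x ∈ U ∧ ContDiffOn ℝ 2 ψ U ∧ (∀ y ∈ U, fderiv ℝ ψ y ≠ 0) ∧ ψ x = 0 ∧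
    ∀ y ∈ U, (y ∈ Ω ↔ ψ y < 0)

/-- The surface measure on `∂Ω`. -/
def surfaceMeasure (Ω : TopologicalSpace.Opens R3) : Measure R3 :=
  (μHE[2] : Measure R3).restrict (frontier (Ω : Set R3))

/-- `θ̃ ∈ L^∞(0, T; H¹(Ω))` with `θ̃_t ∈ L²(0, T; L²(Ω))` is the weak solution of
`θ̃_t - Δθ̃ = 0` in `Ω × (0, T)`, `∂θ̃/∂n = g` on `∂Ω × (0, T)`, `θ̃(0) = 0`. -/
def SolvesBoundaryProblem (Ω : TopologicalSpace.Opens R3) (T : ℝ) (g θtil : ℝ → R3 → ℝ) : Prop :=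
  ∃ (θtil' : ℝ → R3 → ℝ) (G : ℝ → R3 → R3),
    InH1TimeFrom (spaceMeasure Ω) T θtil θtil' (fun _ => 0) ∧
    MemL2L2 (spaceMeasure Ω) T G ∧
    (∀ᵐ t ∂timeMeasure T, InH1 Ω (θtil t) (G t)) ∧
    (∃ B : ℝ≥0, ∀ᵐ t ∂timeMeasure T,
      eLpNorm (θtil t) 2 (spaceMeasure Ω) ≤ B ∧ eLpNorm (G t) 2 (spaceMeasure Ω) ≤ B) ∧
    ∀ᵐ t ∂timeMeasure T, ∀ φ : 𝓓((⊤ : TopologicalSpace.Opens R3), ℝ),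
      ∫ x in (Ω : Set R3), (θtil' t x * φ x + inner ℝ (G t x) (∇ φ x)) =
        ∫ x, g t x * φ x ∂surfaceMeasure Ω

/-! ### The approximate system -/

/-- The unknown functions of the approximate system, listed with their first derivatives. -/
structure Fields where
  /-- displacement `u` -/
  u : ℝ → R3 → R3
  /-- its time derivative `u_t` -/
  ut : ℝ → R3 → R3
  /-- the spatial Jacobian `∇u` -/
  gradU : ℝ → R3 → Mat3
  /-- the spatial Jacobian `∇u_t` -/
  gradUt : ℝ → R3 → Mat3
  /-- the stress `𝕋` -/
  stress : ℝ → R3 → Sym3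
  /-- the plastic strain `ε^p` -/
  ep : ℝ → R3 → Sym3
  /-- its time derivative `ε^p_t` -/
  ept : ℝ → R3 → Sym3
  /-- temperature `θ` -/
  θ : ℝ → R3 → ℝ
  /-- its time derivative `θ_t` -/
  θt : ℝ → R3 → ℝ
  /-- the spatial gradient `∇θ` -/
  gradθ : ℝ → R3 → R3

/-- The thermal term `f (𝒯_{1/λ} (θ + θ̃))`. -/
def thermal (f : ℝ → ℝ) (lam : ℝ) (θ θtil : ℝ → R3 → ℝ) (t : ℝ) (x : R3) : ℝ :=
  f (trunc (1 / lam) (θ t x + θtil t x))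

/-- The stress `σ = D (ε(u) - ε^p) - f (𝒯_{1/λ} (θ + θ̃)) id`. -/
def sigma (D : Sym3 →ₗ[ℝ] Sym3) (f : ℝ → ℝ) (lam : ℝ) (θtil : ℝ → R3 → ℝ) (s : Fields)
    (t : ℝ) (x : R3) : Sym3 :=
  D (symPart (s.gradU t x) - s.ep t x) - thermal f lam s.θ θtil t x • idMat

/-- `L²`-solutions of the Yosida approximation of parameter `λ` with truncation at height `1/λ`,
with homogeneous Dirichlet condition for the displacement, homogeneous Neumann condition for the
temperature, and initial data `u₀` (with Jacobian `gradU₀`), `ε^{p,0}`, `θ₀`. -/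
structure IsApproxSolution (Ω : TopologicalSpace.Opens R3) (T : ℝ) (D : Sym3 →ₗ[ℝ] Sym3) (k : ℝ)
    (f : ℝ → ℝ) (F : ℝ → R3 → R3) (u₀ : R3 → R3) (gradU₀ : R3 → Mat3) (ep₀ : R3 → Sym3)
    (θ₀ : R3 → ℝ) (θtil : ℝ → R3 → ℝ) (lam : ℝ) (s : Fields) : Prop where
  /-- `u ∈ H¹(0, T; H¹₀(Ω; ℝ³))` and `u(0) = u₀`: the time derivative is that of an
  `H¹`-valued function, so it is taken of `u` and of `∇u`. -/
  u_time : InH1TimeFrom (spaceMeasure Ω) T s.u s.ut u₀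
  gradU_time : InH1TimeFrom (spaceMeasure Ω) T s.gradU s.gradUt gradU₀
  u_space : ∀ᵐ t ∂timeMeasure T, InH10Vec Ω (s.u t) (s.gradU t)
  ut_space : ∀ᵐ t ∂timeMeasure T, InH10Vec Ω (s.ut t) (s.gradUt t)
  /-- `ε^p ∈ H¹(0, T; L²(Ω; 𝒮))` and `ε^p(0) = ε^{p,0}` -/
  ep_time : InH1TimeFrom (spaceMeasure Ω) T s.ep s.ept ep₀
  /-- `θ ∈ H¹(0, T; L²(Ω)) ∩ L²(0, T; H¹(Ω))` and `θ(0) = θ₀` -/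
  θ_time : InH1TimeFrom (spaceMeasure Ω) T s.θ s.θt θ₀
  gradθ_memL2 : MemL2L2 (spaceMeasure Ω) T s.gradθ
  θ_space : ∀ᵐ t ∂timeMeasure T, InH1 Ω (s.θ t) (s.gradθ t)
  /-- `𝕋 = D (ε(u) - ε^p)` -/
  stress_eq : ∀ᵐ p ∂(timeMeasure T).prod (spaceMeasure Ω),
    s.stress p.1 p.2 = D (symPart (s.gradU p.1 p.2) - s.ep p.1 p.2)
  /-- `ε^p_t = Y_λ(𝕋)` -/
  flow_rule : ∀ᵐ p ∂(timeMeasure T).prod (spaceMeasure Ω),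
    s.ept p.1 p.2 = yosida lam k (s.stress p.1 p.2)
  /-- `div (σ + D ε(u_t)) = -F` in the sense of distributions on `Ω` -/
  momentum : ∀ᵐ t ∂timeMeasure T, ∀ φ : 𝓓(Ω, R3),
    ∫ x in (Ω : Set R3),
        inner ℝ ((sigma D f lam θtil s t x + D (symPart (s.gradUt t x)) : Sym3) : Mat3)
          (jacobian φ x) =
      ∫ x in (Ω : Set R3), inner ℝ (F t x) (φ x)
  /-- `θ_t - Δθ = - f (𝒯_{1/λ} (θ + θ̃)) div u_t + 𝒯_{1/λ} (ε^p_t : 𝕋)` with `∂θ/∂n = 0` -/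
  heat : ∀ᵐ t ∂timeMeasure T, ∀ (φ : R3 → ℝ) (G : R3 → R3), InH1 Ω φ G →
    ∫ x in (Ω : Set R3), (s.θt t x * φ x + inner ℝ (s.gradθ t x) (G x)) =
      ∫ x in (Ω : Set R3),
        (-(thermal f lam s.θ θtil t x * tr (s.gradUt t x)) +
          trunc (1 / lam) (inner ℝ (s.ept t x) (s.stress t x))) * φ x

end ThermoPlast

end

noncomputable section

namespace ThermoPlast

/-! ### Absolutely continuous functions of time -/

/-! Write `A = ε(u) - ε^p` for the elastic strain, so that `𝕋 = D A`. Two estimates suffice, and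
neither differentiates the equations.

1. Dissipation. Test the momentum balance with `u_t` and the heat equation with `η(θ)`, where `η(r)
= r / √(1 + r²)` is a bounded increasing function. The diffusion term `η'(θ)|∇θ|²` has a good sign.
The truncated heating is at most the plastic work `ε^p_t : 𝕋`, which is nonnegative, and `η ≤ 1`, so
it is absorbed by that work. In the sum, the thermal coupling survives only as `f (1 - η(θ)) div
u_t`. For `θ ≥ 0` the factor `1 - η(θ)` decays fast enough to beat the growth of `f`. For `θ < 0`
the square root bound on `f` applies, unless `θ̃` makes the argument of `f` nonnegative, and then
this argument is at most `|θ̃|`. Hence `(f (1 - η))² ≤ K (1 + |θ| + θ̃²)` uniformly in `λ`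
(`exists_thermal_bound`). Young's and Poincaré's inequalities absorb the rest into `D ε(u_t) :
ε(u_t)` (`energy_inequality`). Since `∫ η = √(1 + r²)` controls `|r|`, Grönwall's inequality closes
the estimate and bounds `∫∫ D ε(u_t) : ε(u_t)` (`exists_dissipation_bound`).

2. Stress rate. The Yosida approximation is the gradient of a nonnegative Moreau envelope `M_λ`, and
`M_λ(𝕋(0)) = 0` because the initial stress is admissible. Therefore `∫∫ ε^p_t : 𝕋_t = ∫ M_λ(𝕋(T)) ≥
0`. Expanding `D ε(u_t) : ε(u_t)` with `ε(u_t) = A_t + ε^p_t` gives `∫∫ D A_t : A_t ≤ ∫∫ D ε(u_t) :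
ε(u_t)` (`IsApproxSolution.integral_stressDeriv_le`), and coercivity of `D` turns this into a bound
on `𝕋_t = D A_t`.

The remaining work justifies the tests and the chain rules: in time through absolutely continuous
representatives for a.e. `x` followed by Fubini, in space through mollification. -/

theorem absolutelyContinuousOnInterval_of_dist_le {X Y : Type*} [PseudoMetricSpace X]
    [PseudoMetricSpace Y] {f : ℝ → X} {g : ℝ → Y} {a b K : ℝ}
    (h : ∀ s ∈ uIcc a b, ∀ t ∈ uIcc a b, dist (f s) (f t) ≤ K * dist (g s) (g t))
    (hg : AbsolutelyContinuousOnInterval g a b) : AbsolutelyContinuousOnInterval f a b := by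
  have h0 := Tendsto.const_mul K hg
  rw [mul_zero] at h0
  refine squeeze_zero' (Eventually.of_forall fun E => Finset.sum_nonneg fun _ _ => dist_nonneg)
    ?_ h0
  have : ∀ᶠ E in AbsolutelyContinuousOnInterval.totalLengthFilter ⊓
      𝓟 (AbsolutelyContinuousOnInterval.disjWithin a b),
      E ∈ AbsolutelyContinuousOnInterval.disjWithin a b :=
    eventually_inf_principal.mpr (by simp)
  filter_upwards [this] with E hE
  rw [Finset.mul_sum]
  exact Finset.sum_le_sum fun i hi => h _ (hE.1 i hi).1 _ (hE.1 i hi).2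

section Primitive

variable {V : Type*} [NormedAddCommGroup V] [NormedSpace ℝ V]

theorem continuousOn_add_primitive {w' : ℝ → V} {τ : ℝ} (hw : IntervalIntegrable w' volume 0 τ)
    (w0 : V) : ContinuousOn (fun t => w0 + ∫ s in (0 : ℝ)..t, w' s) (uIcc 0 τ) :=
  continuousOn_const.add (intervalIntegral.continuousOn_primitive_interval
    (by rwa [intervalIntegrable_iff', ] at hw))

/-- The curve has bounded range, on which the growth bound makes `Φ` Lipschitz. Increments of `Φ ∘
w` are thus controlled by those of `∫ ‖w'‖`, so `Φ ∘ w` is absolutely continuous and the fundamental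
theorem of calculus applies; continuity of `Φ'` is not needed. -/
theorem integral_chain_rule [CompleteSpace V] {Φ : V → ℝ} {Φ' : V → V →L[ℝ] ℝ}
    (hΦ : ∀ v, HasFDerivAt Φ (Φ' v) v) {C : ℝ} (hC : ∀ v, ‖Φ' v‖ ≤ C * (1 + ‖v‖))
    {w' : ℝ → V} {τ : ℝ} (hw : IntervalIntegrable w' volume 0 τ) (w0 : V) :
    ∫ t in (0 : ℝ)..τ, Φ' (w0 + ∫ s in (0 : ℝ)..t, w' s) (w' t) =
      Φ (w0 + ∫ s in (0 : ℝ)..τ, w' s) - Φ w0 := by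
  set w : ℝ → V := fun t => w0 + ∫ s in (0 : ℝ)..t, w' s with hwdef
  have hcont : ContinuousOn w (uIcc 0 τ) := continuousOn_add_primitive hw w0
  obtain ⟨R, hR⟩ := (isCompact_uIcc.image_of_continuousOn hcont).isBounded.exists_norm_le
  have hR0 : 0 ≤ R := (norm_nonneg _).trans (hR (w 0) ⟨0, by simp, rfl⟩)
  have hC0 : 0 ≤ C := by
    have h := (norm_nonneg _).trans (hC 0)
    simpa using h
  have hLip : ∀ s ∈ uIcc 0 τ, ∀ t ∈ uIcc 0 τ,
      dist (Φ (w s)) (Φ (w t)) ≤ C * (1 + R) *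
        dist (∫ r in (0 : ℝ)..s, ‖w' r‖) (∫ r in (0 : ℝ)..t, ‖w' r‖) := by
    intro s hs t ht
    have h1 : ‖Φ (w s) - Φ (w t)‖ ≤ C * (1 + R) * ‖w s - w t‖ := by
      refine Convex.norm_image_sub_le_of_norm_hasFDerivWithin_le (s := Metric.closedBall 0 R)
        (f' := Φ') (fun v _ => (hΦ v).hasFDerivWithinAt) ?_ (convex_closedBall 0 R) ?_ ?_
      · intro v hv
        have : ‖v‖ ≤ R := by simpa using hv
        exact (hC v).trans (by gcongr)
      · simpa using hR _ ⟨t, ht, rfl⟩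
      · simpa using hR _ ⟨s, hs, rfl⟩
    have his : IntervalIntegrable w' volume 0 s :=
      hw.mono_set (uIcc_subset_uIcc left_mem_uIcc hs)
    have hit : IntervalIntegrable w' volume 0 t :=
      hw.mono_set (uIcc_subset_uIcc left_mem_uIcc ht)
    rw [Real.dist_eq, Real.dist_eq, ← Real.norm_eq_abs]
    refine h1.trans (mul_le_mul_of_nonneg_left ?_ (by positivity))
    have h2 : w s - w t = ∫ r in t..s, w' r := by
      simp only [hwdef, add_sub_add_left_eq_sub]
      exact intervalIntegral.integral_interval_sub_left his hit
    rw [h2, intervalIntegral.integral_interval_sub_left his.norm hit.norm]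
    exact intervalIntegral.norm_integral_le_abs_integral_norm
  have hac : AbsolutelyContinuousOnInterval (fun t => Φ (w t)) 0 τ :=
    absolutelyContinuousOnInterval_of_dist_le hLip
      (hw.norm.absolutelyContinuousOnInterval_intervalIntegral left_mem_uIcc)
  have h3 := hac.integral_deriv_eq_sub
  have h4 : w 0 = w0 := by simp [hwdef]
  rw [h4] at h3
  rw [← h3]
  refine intervalIntegral.integral_congr_ae ?_
  filter_upwards [hw.ae_hasDerivAt_integral] with t ht ht'
  have h5 : HasDerivAt w (w' t) t := (ht (uIoc_subset_uIcc ht') 0 left_mem_uIcc).const_add w0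
  exact ((hΦ (w t)).comp_hasDerivAt t h5).deriv.symm

end Primitive

/-! ### Weak time derivatives -/

/-- A test function on `(-∞, T)` whose derivative on `[0, T)` is a given test function on
`(0, T)`. -/
theorem exists_testFunction_deriv_eq {T : ℝ} (hT : 0 < T) {η : ℝ → ℝ}
    (hη : ContDiff ℝ ((⊤ : ℕ∞) : WithTop ℕ∞) η)
    (hsupp : HasCompactSupport η) (hsub : tsupport η ⊆ Ioo 0 T) :
    ∃ φ : 𝓓((⟨Iio T, isOpen_Iio⟩ : TopologicalSpace.Opens ℝ), ℝ),
      ∀ t ∈ Ioo 0 T, deriv φ t = η t := by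
  have hηc : Continuous η := hη.continuous
  set p : ℝ → ℝ := fun t => ∫ s in T..t, η s with hp
  have hpd : ∀ t, HasDerivAt p (η t) t := fun t =>
    intervalIntegral.integral_hasDerivAt_right (hηc.intervalIntegrable _ _)
      (hηc.stronglyMeasurableAtFilter _ _) hηc.continuousAt
  have hpsm : ContDiff ℝ ((⊤ : ℕ∞) : WithTop ℕ∞) p := by
    rw [contDiff_infty_iff_deriv]
    refine ⟨fun t => (hpd t).differentiableAt, ?_⟩
    rwa [show deriv p = η from funext fun t => (hpd t).deriv]
  -- To the left of the support of `η` the primitive is a constant, in general not zero. A cutoff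
  -- equal to `1` on `[-T, T]` makes its support compact without changing it on `(0, T)`.
  let b : ContDiffBump (0 : ℝ) := ⟨T, T + 1, hT, by linarith⟩
  -- `p` vanishes to the right of the support of `η`
  obtain ⟨S, hS0, hST, hS⟩ : ∃ S, 0 ≤ S ∧ S < T ∧ ∀ t, S < t → η t = 0 := by
    rcases (tsupport η).eq_empty_or_nonempty with he | hne
    · exact ⟨0, le_rfl, hT, fun t _ => image_eq_zero_of_notMem_tsupport (by simp [he])⟩
    · obtain ⟨S, hSm, hmax⟩ := IsCompact.exists_isMaxOn hsupp hne continuousOn_id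
      refine ⟨S, (hsub hSm).1.le, (hsub hSm).2, fun t ht => ?_⟩
      refine image_eq_zero_of_notMem_tsupport fun hmem => ?_
      exact absurd (hmax hmem) (not_le.mpr ht)
  have hpz : ∀ t, S < t → p t = 0 := by
    intro t ht
    refine (intervalIntegral.integral_congr (g := fun _ => (0 : ℝ)) fun s hs => ?_).trans (by simp)
    refine hS s (lt_of_lt_of_le (lt_min hST ht) hs.1)
  have hts : tsupport (fun t => b t * p t) ⊆ Icc (-(T + 1)) S := by
    refine closure_minimal ?_ isClosed_Icc
    intro t ht
    have h1 : b t ≠ 0 := left_ne_zero_of_mul ht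
    have h2 : p t ≠ 0 := right_ne_zero_of_mul ht
    have h3 : t ∈ Metric.ball (0 : ℝ) (T + 1) := by
      have := b.support_eq
      rw [← this]; exact h1
    refine ⟨?_, ?_⟩
    · have := Metric.mem_ball.1 h3
      rw [Real.dist_eq, sub_zero] at this
      exact (abs_lt.1 this).1.le
    · by_contra! h
      exact h2 (hpz t h)
  refine ⟨⟨fun t => b t * p t, b.contDiff.mul hpsm, ?_, ?_⟩, ?_⟩
  · exact HasCompactSupport.of_support_subset_isCompact isCompact_Icc
      ((subset_tsupport _).trans hts)
  · exact hts.trans fun t ht => lt_of_le_of_lt ht.2 hST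
  · intro t ht
    change deriv (fun t => b t * p t) t = η t
    have hev : (fun t => b t * p t) =ᶠ[𝓝 t] p := by
      filter_upwards [isOpen_Ioo.mem_nhds ht] with s hs
      rw [b.one_of_mem_closedBall (by
        simp only [Metric.mem_closedBall, Real.dist_eq, sub_zero]
        rw [abs_of_pos hs.1]; exact hs.2.le), one_mul]
    rw [hev.deriv_eq, (hpd t).deriv]

theorem integral_deriv_mul_add_primitive {T : ℝ} (hT : 0 < T) {w' : ℝ → ℝ} {w0 : ℝ}
    (hw' : IntervalIntegrable w' volume 0 T)
    (φ : 𝓓((⟨Iio T, isOpen_Iio⟩ : TopologicalSpace.Opens ℝ), ℝ)) :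
    ∫ t in Ioo 0 T, deriv φ t * (w0 + ∫ s in (0 : ℝ)..t, w' s) =
      -(φ 0 * w0) - ∫ t in Ioo 0 T, φ t * w' t := by
  have hφ : ContDiff ℝ 1 φ := φ.contDiff.of_le (by simp)
  have hφT : φ T = 0 :=
    image_eq_zero_of_notMem_tsupport fun h => lt_irrefl T (φ.tsupport_subset h)
  have h1 : AbsolutelyContinuousOnInterval (fun t => φ t) 0 T :=
    hφ.contDiffOn.absolutelyContinuousOnInterval
  have h2 : AbsolutelyContinuousOnInterval (fun t => w0 + ∫ s in (0 : ℝ)..t, w' s) 0 T :=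
    (LipschitzWith.const w0).lipschitzOnWith.absolutelyContinuousOnInterval.add
      (hw'.absolutelyContinuousOnInterval_intervalIntegral left_mem_uIcc)
  have h3 := h1.integral_mul_deriv_eq_deriv_mul h2
  have h4 : ∫ t in (0 : ℝ)..T, φ t * deriv (fun t => w0 + ∫ s in (0 : ℝ)..t, w' s) t =
      ∫ t in (0 : ℝ)..T, φ t * w' t := by
    refine intervalIntegral.integral_congr_ae ?_
    filter_upwards [hw'.ae_hasDerivAt_integral] with t ht ht'
    rw [((ht (uIoc_subset_uIcc ht') 0 left_mem_uIcc).const_add w0).deriv]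
  rw [h4] at h3
  simp only [intervalIntegral.integral_of_le hT.le, integral_Ioc_eq_integral_Ioo] at h3 ⊢
  simp only [hφT, zero_mul] at h3
  rw [intervalIntegral.integral_same, add_zero] at h3
  linarith

theorem integrableOn_smul_of_hasCompactSupport {V : Type*} [NormedAddCommGroup V] [NormedSpace ℝ V]
    {v : ℝ → V} {ζ : ℝ → ℝ} {s : Set ℝ} (hζ : Continuous ζ) (hζc : HasCompactSupport ζ)
    (hv : IntegrableOn v s) : IntegrableOn (fun t => ζ t • v t) s := by
  obtain ⟨C, hC⟩ := hζc.exists_bound_of_continuous hζ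
  exact hv.bdd_smul C hζ.aestronglyMeasurable (Eventually.of_forall hC)

/-- The du Bois-Reymond lemma with an initial value. Test functions need not vanish at `0`, so every
`η ∈ C_c^∞(0, T)`, with no mean value condition, is the derivative of one of them. The difference of
the two sides is thus orthogonal to all `η`, and no free constant remains. -/
theorem ae_eq_add_primitive {V : Type*} [NormedAddCommGroup V] [NormedSpace ℝ V] [CompleteSpace V]
    {T : ℝ} (hT : 0 < T) {w w' : ℝ → V} {w0 : V}
    (hw : IntegrableOn w (Ioo 0 T)) (hw' : IntegrableOn w' (Ioo 0 T))
    (h : ∀ φ : 𝓓((⟨Iio T, isOpen_Iio⟩ : TopologicalSpace.Opens ℝ), ℝ),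
      ∫ t in Ioo 0 T, deriv φ t • w t = -(φ 0 • w0) - ∫ t in Ioo 0 T, φ t • w' t) :
    ∀ᵐ t ∂timeMeasure T, w t = w0 + ∫ s in (0 : ℝ)..t, w' s := by
  have hii : IntervalIntegrable w' volume 0 T := by
    rwa [intervalIntegrable_iff_integrableOn_Ioo_of_le hT.le]
  have hwc : IntegrableOn (fun t => w0 + ∫ s in (0 : ℝ)..t, w' s) (Ioo 0 T) := by
    have := continuousOn_add_primitive hii w0
    rw [uIcc_of_le hT.le] at this
    exact (this.integrableOn_Icc).mono_set Ioo_subset_Icc_self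
  have hd : IntegrableOn (fun t => w t - (w0 + ∫ s in (0 : ℝ)..t, w' s)) (Ioo 0 T) := hw.sub hwc
  have key := isOpen_Ioo.ae_eq_zero_of_integral_contDiff_smul_eq_zero (μ := volume)
    hd.locallyIntegrableOn ?_
  · rw [ae_restrict_iff' measurableSet_Ioo]
    filter_upwards [key] with t ht hmem
    exact sub_eq_zero.1 (ht hmem)
  intro η hη hsupp hsub
  obtain ⟨φ, hφ⟩ := exists_testFunction_deriv_eq hT hη hsupp hsub
  have hφc : Continuous (deriv φ) :=
    (φ.contDiff.of_le (by simp : (1 : WithTop ℕ∞) ≤ _)).continuous_deriv le_rfl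
  have e1 : ∫ t, η t • (w t - (w0 + ∫ s in (0 : ℝ)..t, w' s)) =
      ∫ t in Ioo 0 T, deriv φ t • (w t - (w0 + ∫ s in (0 : ℝ)..t, w' s)) := by
    rw [← setIntegral_eq_integral_of_forall_compl_eq_zero (s := Ioo 0 T)]
    · refine setIntegral_congr_fun measurableSet_Ioo fun t ht => ?_
      simp only [hφ t ht]
    · intro t ht
      rw [image_eq_zero_of_notMem_tsupport fun hmem => ht (hsub hmem), zero_smul]
  rw [e1]
  -- Functionals reduce the claim to real functions, where integration by parts for absolutely
  -- continuous functions is available.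
  refine SeparatingDual.eq_zero_of_forall_dual_eq_zero (R := ℝ) fun ℓ => ?_
  have i1 := integrableOn_smul_of_hasCompactSupport hφc φ.hasCompactSupport.deriv hw
  have i2 := integrableOn_smul_of_hasCompactSupport hφc φ.hasCompactSupport.deriv hwc
  have i3 := integrableOn_smul_of_hasCompactSupport φ.continuous φ.hasCompactSupport hw'
  simp only [smul_sub]
  rw [integral_sub i1 i2, map_sub, h φ, map_sub, map_neg, map_smul]
  rw [← ContinuousLinearMap.integral_comp_comm ℓ i3, ← ContinuousLinearMap.integral_comp_comm ℓ i2]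
  have h5 := integral_deriv_mul_add_primitive (w' := fun t => ℓ (w' t)) (w0 := ℓ w0) hT
    (by
      rw [intervalIntegrable_iff_integrableOn_Ioo_of_le hT.le]
      exact ℓ.integrable_comp hw') φ
  simp only [map_smul, smul_eq_mul, map_add]
  have h6 : ∫ t in Ioo 0 T, deriv φ t * (ℓ w0 + ℓ (∫ s in (0 : ℝ)..t, w' s)) =
      ∫ t in Ioo 0 T, deriv φ t * (ℓ w0 + ∫ s in (0 : ℝ)..t, ℓ (w' s)) := by
    refine setIntegral_congr_fun measurableSet_Ioo fun t ht => ?_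
    have : IntervalIntegrable w' volume 0 t := hii.mono_set (by
      rw [uIcc_of_le ht.1.le, uIcc_of_le hT.le]; exact Icc_subset_Icc le_rfl ht.2.le)
    simp only [ContinuousLinearMap.intervalIntegral_comp_comm ℓ this]
  rw [h6, h5]
  ring

section SpaceTime

variable {X V W : Type*} [MeasurableSpace X] [NormedAddCommGroup V] [NormedAddCommGroup W]
  {μ : Measure X} {T : ℝ}

instance isFiniteMeasure_timeMeasure : IsFiniteMeasure (timeMeasure T) :=
  ⟨by simp [timeMeasure]⟩

theorem MemL2L2.integrable [IsFiniteMeasure μ] {w : ℝ → X → V} (h : MemL2L2 μ T w) :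
    Integrable (fun p : ℝ × X => w p.1 p.2) ((timeMeasure T).prod μ) :=
  MemLp.integrable (by norm_num) h

theorem MemL2L2.sub {w v : ℝ → X → V} (hw : MemL2L2 μ T w) (hv : MemL2L2 μ T v) :
    MemL2L2 μ T (fun t x => w t x - v t x) := MemLp.sub hw hv

theorem MemL2L2.ae_memLp [SFinite μ] {w : ℝ → X → V} (h : MemL2L2 μ T w) :
    ∀ᵐ t ∂timeMeasure T, MemLp (w t) 2 μ := by
  have h1 : ∀ᵐ t ∂timeMeasure T, AEStronglyMeasurable (w t) μ :=
    h.aestronglyMeasurable.prodMk_left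
  have h2 := ((memLp_two_iff_integrable_sq_norm h.aestronglyMeasurable).1 h).prod_right_ae
  filter_upwards [h1, h2] with t ht1 ht2
  exact (memLp_two_iff_integrable_sq_norm ht1).2 ht2

theorem MemL2L2.ae_time_integrableOn [IsFiniteMeasure μ] {w : ℝ → X → V} (h : MemL2L2 μ T w) :
    ∀ᵐ x ∂μ, IntegrableOn (fun t => w t x) (Ioo 0 T) :=
  h.integrable.prod_left_ae

variable [NormedSpace ℝ V] [NormedSpace ℝ W]

theorem MemL2L2.clm {w : ℝ → X → V} (h : MemL2L2 μ T w) (L : V →L[ℝ] W) :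
    MemL2L2 μ T (fun t x => L (w t x)) := L.comp_memLp' h

theorem ae_time_ae_of_ae_prod [SFinite μ] {p : ℝ × X → Prop}
    (h : ∀ᵐ z ∂(timeMeasure T).prod μ, p z) :
    ∀ᵐ x ∂μ, ∀ᵐ t ∂timeMeasure T, p (t, x) :=
  Measure.ae_ae_of_ae_prod (Measure.measurePreserving_swap.quasiMeasurePreserving.ae h)

theorem integrableOn_testFunction_smul {Ω : TopologicalSpace.Opens ℝ} (φ : 𝓓(Ω, ℝ)) {w v : ℝ → V}
    {s : Set ℝ} (hw : IntegrableOn w s) (hv : IntegrableOn v s) :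
    IntegrableOn (fun t => deriv φ t • w t) s ∧ IntegrableOn (fun t => φ t • v t) s := by
  have hφc : Continuous (deriv φ) :=
    (φ.contDiff.of_le (by simp : (1 : WithTop ℕ∞) ≤ _)).continuous_deriv le_rfl
  exact ⟨integrableOn_smul_of_hasCompactSupport hφc φ.hasCompactSupport.deriv hw,
    integrableOn_smul_of_hasCompactSupport φ.continuous φ.hasCompactSupport hv⟩

theorem HasWeakTimeDerivFrom.clm [IsFiniteMeasure μ] [CompleteSpace V] [CompleteSpace W]
    {w wt : ℝ → X → V} {w₀ : X → V}
    (h : InH1TimeFrom μ T w wt w₀) (L : V →L[ℝ] W) :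
    HasWeakTimeDerivFrom μ T (fun t x => L (w t x)) (fun t x => L (wt t x))
      (fun x => L (w₀ x)) := by
  filter_upwards [h.weakDeriv, h.memL2.ae_time_integrableOn, h.deriv_memL2.ae_time_integrableOn]
    with x hx hw hwt φ
  obtain ⟨i1, i2⟩ := integrableOn_testFunction_smul φ hw hwt
  have h1 := congrArg L (hx φ)
  rw [← L.integral_comp_comm i1, map_sub, map_neg, ← L.integral_comp_comm i2] at h1
  simpa only [map_smul] using h1

theorem InH1TimeFrom.clm [IsFiniteMeasure μ] [CompleteSpace V] [CompleteSpace W]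
    {w wt : ℝ → X → V} {w₀ : X → V}
    (h : InH1TimeFrom μ T w wt w₀) (L : V →L[ℝ] W) :
    InH1TimeFrom μ T (fun t x => L (w t x)) (fun t x => L (wt t x)) (fun x => L (w₀ x)) :=
  ⟨h.memL2.clm L, h.deriv_memL2.clm L, HasWeakTimeDerivFrom.clm h L⟩

theorem InH1TimeFrom.sub [IsFiniteMeasure μ] [CompleteSpace V]
    {w wt v vt : ℝ → X → V} {w₀ v₀ : X → V}
    (hw : InH1TimeFrom μ T w wt w₀) (hv : InH1TimeFrom μ T v vt v₀) :
    InH1TimeFrom μ T (fun t x => w t x - v t x) (fun t x => wt t x - vt t x)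
      (fun x => w₀ x - v₀ x) := by
  refine ⟨hw.memL2.sub hv.memL2, hw.deriv_memL2.sub hv.deriv_memL2, ?_⟩
  filter_upwards [hw.weakDeriv, hw.memL2.ae_time_integrableOn,
    hw.deriv_memL2.ae_time_integrableOn, hv.weakDeriv, hv.memL2.ae_time_integrableOn,
    hv.deriv_memL2.ae_time_integrableOn] with x hx i1 i2 hx' i3 i4 φ
  obtain ⟨j1, j2⟩ := integrableOn_testFunction_smul φ i1 i2
  obtain ⟨j3, j4⟩ := integrableOn_testFunction_smul φ i3 i4
  simp only [smul_sub]
  rw [integral_sub j1 j3, integral_sub j2 j4, hx φ, hx' φ]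
  abel

theorem HasWeakTimeDerivFrom.hasWeakTimeDeriv {w wt : ℝ → X → V} {w₀ : X → V}
    (h : HasWeakTimeDerivFrom μ T w wt w₀) : HasWeakTimeDeriv μ T w wt := by
  filter_upwards [h] with x hx φ
  have h0 : φ 0 = 0 := image_eq_zero_of_notMem_tsupport fun hm =>
    lt_irrefl (0 : ℝ) (φ.tsupport_subset hm).1
  have h1 := hx ⟨φ, φ.contDiff, φ.hasCompactSupport,
    φ.tsupport_subset.trans fun t ht => ht.2⟩
  simpa [h0] using h1

theorem HasWeakTimeDeriv.congr_left [SFinite μ] {w v wt : ℝ → X → V}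
    (h : HasWeakTimeDeriv μ T w wt)
    (hv : ∀ᵐ p ∂(timeMeasure T).prod μ, v p.1 p.2 = w p.1 p.2) : HasWeakTimeDeriv μ T v wt := by
  filter_upwards [h, ae_time_ae_of_ae_prod hv] with x hx hxv φ
  rw [← hx φ]
  refine integral_congr_ae ?_
  filter_upwards [hxv] with t ht
  rw [ht]

/-- The absolutely continuous representative of a function with time derivative `wt` and initial
value `w₀`. -/
def primitive (w₀ : X → V) (wt : ℝ → X → V) (t : ℝ) (x : X) : V :=
  w₀ x + ∫ s in (0 : ℝ)..t, wt s x

theorem InH1TimeFrom.ae_eq_primitive [IsFiniteMeasure μ] [CompleteSpace V] (hT : 0 < T)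
    {w wt : ℝ → X → V} {w₀ : X → V} (h : InH1TimeFrom μ T w wt w₀) :
    ∀ᵐ x ∂μ, ∀ᵐ t ∂timeMeasure T, w t x = primitive w₀ wt t x := by
  filter_upwards [h.weakDeriv, h.memL2.ae_time_integrableOn, h.deriv_memL2.ae_time_integrableOn]
    with x hx hw hwt
  exact ae_eq_add_primitive hT hw hwt hx

theorem InH1TimeFrom.ae_chain_rule [IsFiniteMeasure μ] [CompleteSpace V] (hT : 0 < T)
    {w wt : ℝ → X → V} {w₀ : X → V} (h : InH1TimeFrom μ T w wt w₀)
    {Φ : V → ℝ} {Φ' : V → V →L[ℝ] ℝ} (hΦ : ∀ v, HasFDerivAt Φ (Φ' v) v) {C : ℝ}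
    (hC : ∀ v, ‖Φ' v‖ ≤ C * (1 + ‖v‖)) :
    ∀ᵐ x ∂μ, ∀ τ ∈ Icc 0 T, ∫ t in Ioo 0 τ, Φ' (w t x) (wt t x) =
      Φ (primitive w₀ wt τ x) - Φ (w₀ x) := by
  filter_upwards [h.ae_eq_primitive hT, h.deriv_memL2.ae_time_integrableOn] with x hx hwt τ hτ
  have hii : IntervalIntegrable (fun t => wt t x) volume 0 τ := by
    rw [intervalIntegrable_iff_integrableOn_Ioo_of_le hτ.1]
    exact hwt.mono_set (Ioo_subset_Ioo le_rfl hτ.2)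
  have h1 := integral_chain_rule hΦ hC hii (w₀ x)
  rw [intervalIntegral.integral_of_le hτ.1, integral_Ioc_eq_integral_Ioo] at h1
  refine Eq.trans ?_ h1
  refine integral_congr_ae ?_
  filter_upwards [ae_restrict_of_ae_restrict_of_subset (Ioo_subset_Ioo le_rfl hτ.2) hx] with t ht
  rw [ht, primitive]

theorem timeMeasure_prod_mono [SFinite μ] {τ : ℝ} (hτ : τ ≤ T) :
    (timeMeasure τ).prod μ ≤ (timeMeasure T).prod μ :=
  Measure.prod_mono (Measure.restrict_mono (Ioo_subset_Ioo le_rfl hτ) le_rfl) le_rfl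

/-- The pointwise chain rule integrated over `x`. Using the representative `primitive` makes the
identity hold at every time `τ`, and integrability at time `τ` comes from the identity itself, so no
growth condition on `Φ` enters beyond the one on `Φ'`. -/
theorem InH1TimeFrom.integral_chain_rule [IsFiniteMeasure μ] [CompleteSpace V] (hT : 0 < T)
    {w wt : ℝ → X → V} {w₀ : X → V} (h : InH1TimeFrom μ T w wt w₀)
    {Φ : V → ℝ} {Φ' : V → V →L[ℝ] ℝ} (hΦ : ∀ v, HasFDerivAt Φ (Φ' v) v) {C : ℝ}
    (hC : ∀ v, ‖Φ' v‖ ≤ C * (1 + ‖v‖))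
    (hint : Integrable (fun p : ℝ × X => Φ' (w p.1 p.2) (wt p.1 p.2)) ((timeMeasure T).prod μ))
    (hint₀ : Integrable (fun x => Φ (w₀ x)) μ) {τ : ℝ} (hτ : τ ∈ Icc 0 T) :
    Integrable (fun x => Φ (primitive w₀ wt τ x)) μ ∧
    ∫ t in (0 : ℝ)..τ, ∫ x, Φ' (w t x) (wt t x) ∂μ =
      ∫ x, Φ (primitive w₀ wt τ x) ∂μ - ∫ x, Φ (w₀ x) ∂μ := by
  have hi := hint.mono_measure (timeMeasure_prod_mono hτ.2)
  have h1 : (fun x => Φ (primitive w₀ wt τ x)) =ᵐ[μ]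
      fun x => Φ (w₀ x) + ∫ t in Ioo 0 τ, Φ' (w t x) (wt t x) := by
    filter_upwards [h.ae_chain_rule hT hΦ hC] with x hx
    rw [hx τ hτ]; ring
  have h2 : Integrable (fun x => ∫ t in Ioo 0 τ, Φ' (w t x) (wt t x)) μ :=
    hi.integral_prod_right
  refine ⟨(hint₀.add h2).congr h1.symm, ?_⟩
  rw [integral_congr_ae h1, integral_add hint₀ h2, add_sub_cancel_left,
    intervalIntegral.integral_of_le hτ.1, integral_Ioc_eq_integral_Ioo,
    integral_integral_swap hi]

end SpaceTime

/-! ### Mollification -/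

open scoped Convolution
open ContinuousLinearMap (lsmul)

/-- A sequence of bump functions concentrating at the origin. -/
def mollifierBump (n : ℕ) : ContDiffBump (0 : R3) :=
  ⟨1 / (2 * (n + 1)), 1 / (n + 1), by positivity, by
    apply one_div_lt_one_div_of_lt <;> · have : (0 : ℝ) ≤ n := n.cast_nonneg; linarith⟩

/-- A sequence of mollifiers. -/
def mollifier (n : ℕ) : R3 → ℝ := (mollifierBump n).normed volume

theorem tendsto_rOut_mollifierBump : Tendsto (fun n => (mollifierBump n).rOut) atTop (𝓝 0) :=
  tendsto_one_div_add_atTop_nhds_zero_nat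

theorem ae_tendsto_mollifier_convolution {g : R3 → ℝ} (hg : LocallyIntegrable g) :
    ∀ᵐ x, Tendsto (fun n => (mollifier n ⋆[lsmul ℝ ℝ, volume] g) x) atTop (𝓝 (g x)) := by
  -- The outer radius is exactly twice the inner one, which is the bounded eccentricity that
  -- Lebesgue differentiation asks for.
  refine ContDiffBump.ae_convolution_tendsto_right_of_locallyIntegrable (K := 2)
    tendsto_rOut_mollifierBump (Eventually.of_forall fun n => ?_) hg
  change 1 / ((n : ℝ) + 1) ≤ 2 * (1 / (2 * (n + 1)))
  have : (0 : ℝ) < n + 1 := by positivity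
  field_simp
  exact le_rfl

/-- Scheffé's lemma. -/
theorem tendsto_integral_abs_sub_of_nonneg {X : Type*} [MeasurableSpace X] {μ : Measure X}
    {f : ℕ → X → ℝ} {g : X → ℝ} (hf : ∀ n, Integrable (f n) μ) (hg : Integrable g μ)
    (hf0 : ∀ n, 0 ≤ f n) (hg0 : 0 ≤ g) (hfg : ∀ n, ∫ x, f n x ∂μ = ∫ x, g x ∂μ)
    (hlim : ∀ᵐ x ∂μ, Tendsto (fun n => f n x) atTop (𝓝 (g x))) :
    Tendsto (fun n => ∫ x, |f n x - g x| ∂μ) atTop (𝓝 0) := by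
  -- Equality of the integrals reduces the `L¹` distance to the positive part of `g - f n`, which is
  -- dominated by `g`.
  have h1 : ∀ n, ∫ x, |f n x - g x| ∂μ = 2 * ∫ x, max (g x - f n x) 0 ∂μ := by
    intro n
    have hm : Integrable (fun x => max (g x - f n x) 0) μ := (hg.sub (hf n)).pos_part
    have : ∀ x, |f n x - g x| = (f n x - g x) + 2 * max (g x - f n x) 0 := by
      intro x
      rcases le_total (g x) (f n x) with h | h
      · rw [abs_of_nonneg (by linarith), max_eq_right (by linarith)]; ring
      · rw [abs_of_nonpos (by linarith), max_eq_left (by linarith)]; ring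
    simp only [this]
    rw [integral_add (f := fun x => f n x - g x) ((hf n).sub hg) (hm.const_mul 2), integral_sub (hf n) hg, hfg n, sub_self,
      zero_add, integral_const_mul]
  simp only [h1]
  have h2 : Tendsto (fun n => ∫ x, max (g x - f n x) 0 ∂μ) atTop (𝓝 (∫ _, (0 : ℝ) ∂μ)) := by
    refine tendsto_integral_of_dominated_convergence g
      (fun n => ((hg.sub (hf n)).pos_part).aestronglyMeasurable) hg (fun n => ?_) ?_
    · refine Eventually.of_forall fun x => ?_
      rw [Real.norm_eq_abs, abs_of_nonneg (le_max_right _ _)]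
      exact max_le (by linarith [hf0 n x, show (0 : ℝ) ≤ f n x from hf0 n x]) (hg0 x)
    · filter_upwards [hlim] with x hx
      have := (tendsto_const_nhds (x := g x)).sub hx
      rw [sub_self] at this
      simpa using this.max (tendsto_const_nhds (x := (0 : ℝ)))
  simpa using h2.const_mul 2

/-- Mollification preserves positivity and the integral, so Scheffé's lemma applies to the positive
and negative parts of `g` separately. -/
theorem tendsto_integral_abs_mollifier_convolution_sub {g : R3 → ℝ} (hg : Integrable g) :
    Tendsto (fun n => ∫ x, |(mollifier n ⋆[lsmul ℝ ℝ, volume] g) x - g x|) atTop (𝓝 0) := by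
  have hρ : ∀ n, Integrable (mollifier n) := fun n => (mollifierBump n).integrable_normed
  have hnn : ∀ g : R3 → ℝ, Integrable g → 0 ≤ g →
      Tendsto (fun n => ∫ x, |(mollifier n ⋆[lsmul ℝ ℝ, volume] g) x - g x|) atTop (𝓝 0) := by
    intro g hg h0
    refine tendsto_integral_abs_sub_of_nonneg
      (fun n => (hρ n).integrable_convolution (lsmul ℝ ℝ) hg) hg (fun n x => ?_) h0 (fun n => ?_)
      (ae_tendsto_mollifier_convolution hg.locallyIntegrable)
    · exact integral_nonneg fun t => mul_nonneg ((mollifierBump n).nonneg_normed t) (h0 _)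
    · rw [integral_convolution (lsmul ℝ ℝ) (hρ n) hg]
      simp [mollifier, (mollifierBump n).integral_normed]
  have hp : Integrable (fun x => max (g x) 0) := hg.pos_part
  have hm : Integrable (fun x => max (-g x) 0) := hg.neg_part
  have h1 := (hnn _ hp fun x => le_max_right _ _).add (hnn _ hm fun x => le_max_right _ _)
  rw [add_zero] at h1
  refine squeeze_zero (fun n => integral_nonneg fun x => abs_nonneg _) (fun n => ?_) h1
  have ip : Integrable fun x =>
      (mollifier n ⋆[lsmul ℝ ℝ, volume] fun y => max (g y) 0) x - max (g x) 0 :=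
    ((hρ n).integrable_convolution (lsmul ℝ ℝ) hp).sub hp
  have im : Integrable fun x =>
      (mollifier n ⋆[lsmul ℝ ℝ, volume] fun y => max (-g y) 0) x - max (-g x) 0 :=
    ((hρ n).integrable_convolution (lsmul ℝ ℝ) hm).sub hm
  rw [← integral_add ip.abs im.abs]
  refine integral_mono_of_nonneg (Eventually.of_forall fun x => abs_nonneg _)
    (ip.abs.add im.abs) ?_
  have hex : ∀ {h : R3 → ℝ}, Integrable h → ∀ x,
      ConvolutionExistsAt (mollifier n) h x (lsmul ℝ ℝ) volume := fun hh x =>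
    (mollifierBump n).hasCompactSupport_normed.convolutionExists_left _
      (mollifierBump n).continuous_normed hh.locallyIntegrable x
  refine Eventually.of_forall fun x => ?_
  have hgx : ∀ y, g y = max (g y) 0 - max (-g y) 0 := fun y => by
    rcases le_total (g y) 0 with h | h
    · rw [max_eq_right h, max_eq_left (by linarith)]; ring
    · rw [max_eq_left h, max_eq_right (by linarith)]; ring
  have h2 : (mollifier n ⋆[lsmul ℝ ℝ, volume] g) x =
      (mollifier n ⋆[lsmul ℝ ℝ, volume] fun y => max (g y) 0) x -
      (mollifier n ⋆[lsmul ℝ ℝ, volume] fun y => max (-g y) 0) x := by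
    simp only [convolution_def]
    rw [← integral_sub (hex hp x) (hex hm x)]
    refine integral_congr_ae (Eventually.of_forall fun t => ?_)
    simp only [← map_sub, ← hgx]
  have e : (mollifier n ⋆[lsmul ℝ ℝ, volume] g) x - g x =
      ((mollifier n ⋆[lsmul ℝ ℝ, volume] fun y => max (g y) 0) x - max (g x) 0) -
      ((mollifier n ⋆[lsmul ℝ ℝ, volume] fun y => max (-g y) 0) x - max (-g x) 0) := by
    linarith [hgx x]
  change |(mollifier n ⋆[lsmul ℝ ℝ, volume] g) x - g x| ≤ _
  rw [e]
  exact abs_sub _ _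

/-! ### The chain rule in `H¹(Ω)` -/

theorem integrableOn_of_memLp_two {E : Type*} [NormedAddCommGroup E]
    {Ω : TopologicalSpace.Opens R3} (hΩ : Bornology.IsBounded (Ω : Set R3))
    {w : R3 → E} (h : MemLp w 2 (spaceMeasure Ω)) : IntegrableOn w (Ω : Set R3) := by
  have : IsFiniteMeasure (spaceMeasure Ω) := ⟨by simpa using hΩ.measure_lt_top⟩
  exact h.integrable (by norm_num)

/-- Away from the boundary, `y ↦ ρ (x - y)` is an admissible test function in `Ω`. The definition of
the weak gradient for it is the claim, the two signs cancelling. -/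
theorem fderiv_mollifier_convolution {Ω : TopologicalSpace.Opens R3} {w : R3 → ℝ} {G : R3 → R3}
    (hw : IntegrableOn w (Ω : Set R3)) (h : HasWeakGradient Ω w G) {n : ℕ} {x : R3}
    (hx : Metric.closedBall x (mollifierBump n).rOut ⊆ Ω) (j : Fin 3) :
    fderiv ℝ (mollifier n ⋆[lsmul ℝ ℝ, volume] (Ω : Set R3).indicator w) x
        (EuclideanSpace.single j 1) =
      (mollifier n ⋆[lsmul ℝ ℝ, volume] (Ω : Set R3).indicator fun y => G y j) x := by
  have hρs : HasCompactSupport (mollifier n) := (mollifierBump n).hasCompactSupport_normed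
  have hρc : ContDiff ℝ ((⊤ : ℕ∞) : WithTop ℕ∞) (mollifier n) := (mollifierBump n).contDiff_normed
  have hwi : Integrable ((Ω : Set R3).indicator w) :=
    (integrable_indicator_iff Ω.isOpen.measurableSet).2 hw
  have hd := hρs.hasFDerivAt_convolution_left (lsmul ℝ ℝ) (hρc.of_le (by simp))
    hwi.locallyIntegrable x
  have hex : ConvolutionExistsAt (fderiv ℝ (mollifier n)) ((Ω : Set R3).indicator w) x
      ((lsmul ℝ ℝ).precompL R3) volume :=
    (hρs.fderiv ℝ).convolutionExists_left _
      (hρc.continuous_fderiv (by simp)) hwi.locallyIntegrable x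
  have hcompl : ∀ {y}, y ∉ Metric.closedBall x (mollifierBump n).rOut → mollifier n (x - y) = 0 := by
    intro y hy
    refine image_eq_zero_of_notMem_tsupport fun hm => hy ?_
    rw [mollifier, (mollifierBump n).tsupport_normed_eq] at hm
    rw [mem_closedBall_iff_norm] at hm ⊢
    rw [norm_sub_rev]; simpa using hm
  have hts : tsupport (fun y => mollifier n (x - y)) ⊆ Metric.closedBall x (mollifierBump n).rOut :=
    closure_minimal (fun y hy => by
      by_contra hc
      exact hy (hcompl hc)) Metric.isClosed_closedBall
  let φ : 𝓓(Ω, ℝ) := ⟨fun y => mollifier n (x - y), hρc.comp (contDiff_const.sub contDiff_id),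
    HasCompactSupport.of_support_subset_isCompact (isCompact_closedBall _ _)
      ((subset_tsupport _).trans hts), hts.trans hx⟩
  have hφ : ∀ y, partialDeriv j φ y =
      -(fderiv ℝ (mollifier n) (x - y) (EuclideanSpace.single j 1)) := by
    intro y
    have h1 : HasFDerivAt (mollifier n) (fderiv ℝ (mollifier n) (x - y)) (x - y) :=
      (hρc.differentiable (by simp) _).hasFDerivAt
    have h2 : HasFDerivAt (fun y => mollifier n (x - y))
        ((fderiv ℝ (mollifier n) (x - y)).comp (-ContinuousLinearMap.id ℝ R3)) y :=
      h1.comp y ((hasFDerivAt_id y).const_sub x)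
    change fderiv ℝ (fun y => mollifier n (x - y)) y _ = _
    rw [h2.fderiv]
    simp
  have key := h φ j
  rw [hd.fderiv, convolution_eq_swap]
  have hex' := convolutionExistsAt_iff_integrable_swap.1 hex
  rw [ContinuousLinearMap.integral_apply hex', convolution_eq_swap]
  simp only [hφ] at key
  have e1 : ∫ y, ((lsmul ℝ ℝ).precompL R3 (fderiv ℝ (mollifier n) (x - y))
      ((Ω : Set R3).indicator w y)) (EuclideanSpace.single j 1) =
      ∫ y in (Ω : Set R3), fderiv ℝ (mollifier n) (x - y) (EuclideanSpace.single j 1) * w y := by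
    rw [← integral_indicator Ω.isOpen.measurableSet]
    refine integral_congr_ae (Eventually.of_forall fun y => ?_)
    by_cases hy : y ∈ (Ω : Set R3) <;>
      simp [hy, ContinuousLinearMap.precompL_apply]
  have e2 : ∫ y, lsmul ℝ ℝ (mollifier n (x - y)) ((Ω : Set R3).indicator (fun y => G y j) y) =
      ∫ y in (Ω : Set R3), G y j * mollifier n (x - y) := by
    rw [← integral_indicator Ω.isOpen.measurableSet]
    refine integral_congr_ae (Eventually.of_forall fun y => ?_)
    by_cases hy : y ∈ (Ω : Set R3) <;> simp [hy, mul_comm]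
  rw [e1, e2]
  have e3 : ∫ y in (Ω : Set R3), G y j * φ y = ∫ y in (Ω : Set R3), G y j * mollifier n (x - y) :=
    rfl
  rw [e3] at key
  simp only [mul_neg, integral_neg, neg_inj] at key
  rw [← key]
  simp only [mul_comm]

/-- The classical chain rule and integration by parts hold for the mollifications near the support
of the test function. The limit uses a.e. convergence of `Wn` under the bounded continuous functions
`ψ`, `ψ'`, and `L¹` convergence of the mollified gradients. -/
theorem HasWeakGradient.comp {Ω : TopologicalSpace.Opens R3} {w : R3 → ℝ} {G : R3 → R3}
    (hw : IntegrableOn w (Ω : Set R3)) (hG : IntegrableOn G (Ω : Set R3))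
    (h : HasWeakGradient Ω w G) {ψ ψ' : ℝ → ℝ} (hψ : ∀ r, HasDerivAt ψ (ψ' r) r)
    (hψ' : Continuous ψ') {C : ℝ} (hC : ∀ r, |ψ r| ≤ C) (hC' : ∀ r, |ψ' r| ≤ C) :
    HasWeakGradient Ω (fun x => ψ (w x)) (fun x => ψ' (w x) • G x) := by
  intro φ j
  have hψc : Continuous ψ := continuous_iff_continuousAt.2 fun r => (hψ r).continuousAt
  have hφ1 : ContDiff ℝ 1 φ := φ.contDiff.of_le (by simp)
  have hC0 : 0 ≤ C := (abs_nonneg _).trans (hC 0)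
  set e : R3 := EuclideanSpace.single j 1
  set W : R3 → ℝ := (Ω : Set R3).indicator w
  set g : R3 → ℝ := (Ω : Set R3).indicator fun y => G y j
  have hWi : Integrable W := (integrable_indicator_iff Ω.isOpen.measurableSet).2 hw
  have hgi : Integrable g := (integrable_indicator_iff Ω.isOpen.measurableSet).2
    ((EuclideanSpace.proj (𝕜 := ℝ) j).integrable_comp hG)
  set Wn : ℕ → R3 → ℝ := fun n => mollifier n ⋆[lsmul ℝ ℝ, volume] W
  set gn : ℕ → R3 → ℝ := fun n => mollifier n ⋆[lsmul ℝ ℝ, volume] g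
  have hWn : ∀ n, ContDiff ℝ 1 (Wn n) := fun n =>
    ((mollifierBump n).hasCompactSupport_normed.contDiff_convolution_left (lsmul ℝ ℝ)
      ((mollifierBump n).contDiff_normed (n := 1)) hWi.locallyIntegrable)
  have hgn : ∀ n, Continuous (gn n) := fun n =>
    (mollifierBump n).hasCompactSupport_normed.continuous_convolution_left (lsmul ℝ ℝ)
      (mollifierBump n).continuous_normed hgi.locallyIntegrable
  have hpd : Continuous (partialDeriv j φ) :=
    (hφ1.continuous_fderiv one_ne_zero).clm_apply continuous_const
  have hpds : HasCompactSupport (partialDeriv j φ) :=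
    (φ.hasCompactSupport.fderiv_apply (𝕜 := ℝ) e)
  obtain ⟨B, hB⟩ := φ.hasCompactSupport.exists_bound_of_continuous φ.continuous
  have hB0 : 0 ≤ B := (norm_nonneg _).trans (hB 0)
  -- integration by parts for the mollified function
  have hparts : ∀ᶠ n in atTop, ∫ x, ψ (Wn n x) * partialDeriv j φ x =
      -∫ x, ψ' (Wn n x) * gn n x * φ x := by
    obtain ⟨δ, hδ, hsub⟩ :=
      (show IsCompact (tsupport φ) from φ.hasCompactSupport).exists_cthickening_subset_open
        Ω.isOpen φ.tsupport_subset
    filter_upwards [tendsto_rOut_mollifierBump.eventually (gt_mem_nhds hδ)] with n hn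
    have hfd : ∀ x, HasFDerivAt (fun x => ψ (Wn n x)) (ψ' (Wn n x) • fderiv ℝ (Wn n) x) x :=
      fun x => (hψ (Wn n x)).comp_hasFDerivAt x
        ((hWn n).differentiable one_ne_zero x).hasFDerivAt
    have hfc : Continuous (fun x => fderiv ℝ (fun x => ψ (Wn n x)) x e) := by
      simp only [fun x => (hfd x).fderiv]
      exact ((hψ'.comp (hWn n).continuous).smul
        ((hWn n).continuous_fderiv one_ne_zero)).clm_apply continuous_const
    have hψW : Continuous (fun x => ψ (Wn n x)) := hψc.comp (hWn n).continuous
    have h1 := integral_mul_fderiv_eq_neg_fderiv_mul_of_integrable (μ := (volume : Measure R3))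
      (f := fun x => ψ (Wn n x)) (g := φ) (v := e)
      ((hfc.mul φ.continuous).integrable_of_hasCompactSupport φ.hasCompactSupport.mul_left)
      ((hψW.mul hpd).integrable_of_hasCompactSupport hpds.mul_left)
      ((hψW.mul φ.continuous).integrable_of_hasCompactSupport φ.hasCompactSupport.mul_left)
      (fun x _ => (hfd x).differentiableAt) (fun x _ => hφ1.differentiable one_ne_zero x)
    refine h1.trans (congrArg _ (integral_congr_ae (Eventually.of_forall fun x => ?_)))
    by_cases hx : x ∈ tsupport φ
    · have hball : Metric.closedBall x (mollifierBump n).rOut ⊆ Ω :=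
        (Metric.closedBall_subset_closedBall hn.le).trans
          ((Metric.closedBall_subset_cthickening hx δ).trans hsub)
      have := fderiv_mollifier_convolution hw h hball j
      simp only [(hfd x).fderiv, smul_apply, smul_eq_mul]
      change ψ' (Wn n x) * fderiv ℝ (Wn n) x e * φ x = _
      rw [this]
    · simp [image_eq_zero_of_notMem_tsupport hx]
  have haeW := ae_tendsto_mollifier_convolution hWi.locallyIntegrable
  have lim1 : Tendsto (fun n => ∫ x, ψ (Wn n x) * partialDeriv j φ x) atTop
      (𝓝 (∫ x, ψ (W x) * partialDeriv j φ x)) := by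
    refine tendsto_integral_of_dominated_convergence (fun x => C * ‖partialDeriv j φ x‖)
      (fun n => ((hψc.comp (hWn n).continuous).mul hpd).aestronglyMeasurable)
      ((hpd.integrable_of_hasCompactSupport hpds).norm.const_mul C) (fun n => ?_) ?_
    · refine Eventually.of_forall fun x => ?_
      rw [norm_mul]
      exact mul_le_mul_of_nonneg_right (hC _) (norm_nonneg _)
    · filter_upwards [haeW] with x hx
      exact ((hψc.tendsto _).comp hx).mul_const _
  have lim2 : Tendsto (fun n => ∫ x, ψ' (Wn n x) * g x * φ x) atTop
      (𝓝 (∫ x, ψ' (W x) * g x * φ x)) := by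
    refine tendsto_integral_of_dominated_convergence (fun x => C * ‖g x‖ * B)
      (fun n => (((hψ'.comp (hWn n).continuous).aestronglyMeasurable.mul
        hgi.aestronglyMeasurable).mul φ.continuous.aestronglyMeasurable))
      ((hgi.norm.const_mul C).mul_const B) (fun n => ?_) ?_
    · refine Eventually.of_forall fun x => ?_
      rw [norm_mul, norm_mul]
      gcongr
      exacts [hC' _, hB x]
    · filter_upwards [haeW] with x hx
      exact (((hψ'.tendsto _).comp hx).mul_const _).mul_const _
  have lim3 : Tendsto (fun n => ∫ x, ψ' (Wn n x) * (gn n x - g x) * φ x) atTop (𝓝 0) := by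
    have h0 := (tendsto_integral_abs_mollifier_convolution_sub hgi).const_mul (C * B)
    rw [mul_zero] at h0
    refine squeeze_zero_norm (fun n => ?_) h0
    have hi : Integrable fun x => |gn n x - g x| :=
      ((((mollifierBump n).integrable_normed.integrable_convolution (lsmul ℝ ℝ) hgi)).sub hgi).abs
    rw [← integral_const_mul]
    refine norm_integral_le_of_norm_le (hi.const_mul _) (Eventually.of_forall fun x => ?_)
    rw [norm_mul, norm_mul, Real.norm_eq_abs (gn n x - g x)]
    calc ‖ψ' (Wn n x)‖ * |gn n x - g x| * ‖φ x‖ ≤ C * |gn n x - g x| * B := by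
          gcongr
          exacts [hC' _, hB x]
      _ = C * B * |gn n x - g x| := by ring
  have lim4 : Tendsto (fun n => ∫ x, ψ' (Wn n x) * gn n x * φ x) atTop
      (𝓝 (∫ x, ψ' (W x) * g x * φ x)) := by
    have h0 := lim3.add lim2
    rw [zero_add] at h0
    refine h0.congr fun n => ?_
    have hcb : ∀ᵐ x, ‖ψ' (Wn n x)‖ ≤ C := Eventually.of_forall fun x => hC' _
    have hms : AEStronglyMeasurable (fun x => ψ' (Wn n x)) volume :=
      (hψ'.comp (hWn n).continuous).aestronglyMeasurable
    have hgni : Integrable (gn n) :=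
      (mollifierBump n).integrable_normed.integrable_convolution (lsmul ℝ ℝ) hgi
    have hφb : ∀ᵐ x, ‖φ x‖ ≤ B := Eventually.of_forall hB
    have i1 : Integrable fun x => ψ' (Wn n x) * (gn n x - g x) * φ x :=
      ((hgni.sub hgi).bdd_mul hms hcb).mul_bdd φ.continuous.aestronglyMeasurable hφb
    rw [← integral_add i1
      ((hgi.bdd_mul hms hcb).mul_bdd φ.continuous.aestronglyMeasurable hφb)]
    refine integral_congr_ae (Eventually.of_forall fun x => ?_)
    ring
  have hfin := tendsto_nhds_unique (lim1.congr' hparts) lim4.neg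
  have hφ0 : ∀ x, x ∉ (Ω : Set R3) → φ x = 0 := fun x hx =>
    image_eq_zero_of_notMem_tsupport fun hm => hx (φ.tsupport_subset hm)
  have hpd0 : ∀ x, x ∉ (Ω : Set R3) → partialDeriv j φ x = 0 := fun x hx =>
    image_eq_zero_of_notMem_tsupport fun hm =>
      hx (φ.tsupport_subset (tsupport_fderiv_apply_subset ℝ e hm))
  have f1 : ∫ x in (Ω : Set R3), ψ (w x) * partialDeriv j φ x =
      ∫ x, ψ (W x) * partialDeriv j φ x := by
    rw [← integral_indicator Ω.isOpen.measurableSet]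
    refine integral_congr_ae (Eventually.of_forall fun x => ?_)
    by_cases hx : x ∈ (Ω : Set R3)
    · simp only [indicator_of_mem hx, W]
    · simp only [indicator_of_notMem hx, hpd0 x hx, mul_zero]
  have f2 : ∫ x in (Ω : Set R3), (ψ' (w x) • G x) j * φ x = ∫ x, ψ' (W x) * g x * φ x := by
    rw [← integral_indicator Ω.isOpen.measurableSet]
    refine integral_congr_ae (Eventually.of_forall fun x => ?_)
    by_cases hx : x ∈ (Ω : Set R3)
    · simp only [indicator_of_mem hx, W, g, PiLp.smul_apply, smul_eq_mul]
    · simp only [indicator_of_notMem hx, hφ0 x hx, mul_zero]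
  rw [f1, f2, hfin]

theorem InH1.comp {Ω : TopologicalSpace.Opens R3} (hΩ : Bornology.IsBounded (Ω : Set R3))
    {w : R3 → ℝ} {G : R3 → R3} (h : InH1 Ω w G) {ψ ψ' : ℝ → ℝ} (hψ : ∀ r, HasDerivAt ψ (ψ' r) r)
    (hψ' : Continuous ψ') {C : ℝ} (hC : ∀ r, |ψ r| ≤ C) (hC' : ∀ r, |ψ' r| ≤ C) :
    InH1 Ω (fun x => ψ (w x)) (fun x => ψ' (w x) • G x) := by
  have : IsFiniteMeasure (spaceMeasure Ω) := ⟨by simpa using hΩ.measure_lt_top⟩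
  have hψc : Continuous ψ := continuous_iff_continuousAt.2 fun r => (hψ r).continuousAt
  refine ⟨?_, ?_, h.weakGradient.comp (integrableOn_of_memLp_two hΩ h.memLp)
    (integrableOn_of_memLp_two hΩ h.grad_memLp) hψ hψ' hC hC'⟩
  · exact MemLp.of_bound (hψc.comp_aestronglyMeasurable h.memLp.aestronglyMeasurable) C
      (Eventually.of_forall fun x => hC _)
  · refine MemLp.of_le_mul (c := C) h.grad_memLp
      ((hψ'.comp_aestronglyMeasurable h.memLp.aestronglyMeasurable).smul
        h.grad_memLp.aestronglyMeasurable) (Eventually.of_forall fun x => ?_)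
    rw [norm_smul]
    exact mul_le_mul_of_nonneg_right (hC' _) (norm_nonneg _)

/-! ### Matrices -/

theorem sym_inner_smul_left (c : ℝ) (A B : Sym3) : inner ℝ (c • A) B = c * inner ℝ A B :=
  real_inner_smul_left A B c

theorem sym_inner_smul_right (c : ℝ) (A B : Sym3) : inner ℝ A (c • B) = c * inner ℝ A B :=
  real_inner_smul_right A B c

theorem inner_idMat (A : Sym3) : inner ℝ A idMat = tr (A : Mat3) := by
  rw [Submodule.coe_inner, PiLp.inner_apply, Fintype.sum_prod_type]
  simp [idMat, tr]

theorem tr_idMat : tr (idMat : Mat3) = 3 := by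
  simp [idMat, tr]

/-- `symPart` as a continuous linear map. -/
def symPartL : Mat3 →L[ℝ] Sym3 :=
  LinearMap.toContinuousLinearMap
    { toFun := symPart
      map_add' := by
        intro A B
        ext p
        simp only [symPart, PiLp.add_apply, Submodule.coe_add]
        ring
      map_smul' := by
        intro c A
        ext p
        simp only [symPart, PiLp.smul_apply, Submodule.coe_smul, smul_eq_mul, RingHom.id_apply]
        ring }

@[simp] theorem symPartL_apply (A : Mat3) : symPartL A = symPart A := rfl

theorem inner_coe_eq_inner_symPart (S : Sym3) (G : Mat3) :
    inner ℝ (S : Mat3) G = inner ℝ S (symPart G) := by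
  rw [Submodule.coe_inner, PiLp.inner_apply, PiLp.inner_apply, Fintype.sum_prod_type,
    Fintype.sum_prod_type]
  have h : ∀ i j, (S : Mat3) (i, j) = (S : Mat3) (j, i) := S.2
  simp only [Fin.sum_univ_three, symPart, RCLike.inner_apply, conj_trivial]
  rw [h 1 0, h 2 0, h 2 1]
  ring

theorem tr_symPart (G : Mat3) : tr (symPart G : Mat3) = tr G := by
  simp [symPart, tr]

/-- A matrix and its symmetric part share their diagonal. This is what makes Korn's inequality
unnecessary in the Poincaré estimate below. -/
theorem sum_diag_sq_le (G : Mat3) : ∑ i, G (i, i) ^ 2 ≤ ‖symPart G‖ ^ 2 := by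
  rw [Submodule.coe_norm, EuclideanSpace.real_norm_sq_eq, Fintype.sum_prod_type]
  simp only [Fin.sum_univ_three, symPart]
  nlinarith [sq_nonneg ((G (0, 1) + G (1, 0)) / 2), sq_nonneg ((G (0, 2) + G (2, 0)) / 2),
    sq_nonneg ((G (1, 2) + G (2, 1)) / 2), sq_nonneg ((G (1, 0) + G (0, 1)) / 2),
    sq_nonneg ((G (2, 0) + G (0, 2)) / 2), sq_nonneg ((G (2, 1) + G (1, 2)) / 2)]

theorem inner_dev_idMat (A : Sym3) : inner ℝ (dev A) idMat = 0 := by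
  rw [dev, inner_sub_left, sym_inner_smul_left, inner_idMat, inner_idMat, tr_idMat]
  simp

theorem inner_dev_left (A B : Sym3) : inner ℝ (dev A) (dev B) = inner ℝ (dev A) B := by
  conv_lhs => rw [dev.eq_def B]
  rw [inner_sub_right, sym_inner_smul_right, inner_dev_idMat, mul_zero, sub_zero]

/-- `dev` as a continuous linear map. -/
def devL : Sym3 →L[ℝ] Sym3 :=
  LinearMap.toContinuousLinearMap
    { toFun := dev
      map_add' := by
        intro A B
        simp only [dev, ← inner_idMat, inner_add_left, add_div, add_smul]
        abel
      map_smul' := by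
        intro c A
        simp only [dev, ← inner_idMat, inner_smul_left, RingHom.id_apply, smul_sub, smul_smul,
          conj_trivial, mul_div_assoc] }

@[simp] theorem devL_apply (A : Sym3) : devL A = dev A := rfl

theorem norm_dev_le (A : Sym3) : ‖dev A‖ ≤ ‖A‖ := by
  have h1 : ‖dev A‖ ^ 2 = inner ℝ (dev A) A := by
    rw [← inner_dev_left, real_inner_self_eq_norm_sq]
  have h2 := real_inner_le_norm (dev A) A
  nlinarith [norm_nonneg (dev A), norm_nonneg A]

/-- The constant is the minimum of the quadratic form on the compact unit sphere; an empty sphere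
means a trivial space, where any constant serves. -/
theorem exists_coercive {V : Type*} [NormedAddCommGroup V] [InnerProductSpace ℝ V]
    [FiniteDimensional ℝ V] (D : V →ₗ[ℝ] V) (hD : ∀ A : V, A ≠ 0 → 0 < inner ℝ (D A) A) :
    ∃ c : ℝ, 0 < c ∧ ∀ A : V, c * ‖A‖ ^ 2 ≤ inner ℝ (D A) A := by
  have hcont : Continuous fun A : V => (inner ℝ (D A) A : ℝ) :=
    (LinearMap.continuous_of_finiteDimensional D).inner continuous_id
  have hscale : ∀ A : V, A ≠ 0 → ‖A‖⁻¹ • A ∈ Metric.sphere (0 : V) 1 := by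
    intro A hA
    simp [norm_smul, norm_ne_zero_iff.2 hA]
  rcases (Metric.sphere (0 : V) 1).eq_empty_or_nonempty with he | hne
  · refine ⟨1, one_pos, fun A => ?_⟩
    by_cases hA : A = 0
    · simp [hA]
    · exact absurd (hscale A hA) (by simp [he])
  · obtain ⟨B, hB, hmin⟩ := (isCompact_sphere (0 : V) 1).exists_isMinOn hne hcont.continuousOn
    have hB0 : B ≠ 0 := by
      rintro rfl
      simp at hB
    refine ⟨_, hD B hB0, fun A => ?_⟩
    by_cases hA : A = 0
    · simp [hA]
    · have h1 := hmin (hscale A hA)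
      simp only [mem_ofPred_eq, map_smul, inner_smul_left, inner_smul_right, conj_trivial] at h1
      have h2 : 0 < ‖A‖ := norm_pos_iff.2 hA
      calc _ ≤ (‖A‖⁻¹ * (‖A‖⁻¹ * inner ℝ (D A) A)) * ‖A‖ ^ 2 := by gcongr
        _ = _ := by field_simp

theorem inner_yosida_self_nonneg {lam : ℝ} (hlam : 0 < lam) (k : ℝ) (A : Sym3) :
    0 ≤ inner ℝ (yosida lam k A) A := by
  rw [yosida, sym_inner_smul_left, sym_inner_smul_left, ← inner_dev_left, real_inner_self_eq_norm_sq]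
  positivity

/-- Supplies the linear growth that the chain rule requires of the derivative. The factor `1 / (2 *
lam)` is harmless: it never enters the final estimate. -/
theorem norm_yosida_le {lam k : ℝ} (hlam : 0 < lam) (hk : 0 < k) (A : Sym3) :
    ‖yosida lam k A‖ ≤ 1 / (2 * lam) * ‖A‖ := by
  have h0 : ‖‖dev A‖⁻¹ • dev A‖ ≤ 1 := by
    rw [norm_smul, norm_inv, norm_norm]
    exact inv_mul_le_one
  have h1 : max 0 (‖dev A‖ - k) ≤ ‖A‖ :=
    max_le (norm_nonneg _) (by linarith [norm_dev_le A])
  rw [yosida, norm_smul, Real.norm_of_nonneg (by positivity)]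
  calc max 0 (‖dev A‖ - k) / (2 * lam) * ‖‖dev A‖⁻¹ • dev A‖
      ≤ ‖A‖ / (2 * lam) * 1 := by gcongr
    _ = _ := by ring

theorem hasDerivAt_max_zero_sq (r : ℝ) :
    HasDerivAt (fun r : ℝ => max 0 r ^ 2) (2 * max 0 r) r := by
  rcases lt_trichotomy r 0 with h | rfl | h
  · have : (fun r : ℝ => max 0 r ^ 2) =ᶠ[𝓝 r] fun _ => (0 : ℝ) := by
      filter_upwards [gt_mem_nhds h] with s hs
      simp [max_eq_left hs.le]
    rw [max_eq_left h.le, mul_zero]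
    exact (hasDerivAt_const r (0 : ℝ)).congr_of_eventuallyEq this
  · simp only [max_self, mul_zero]
    rw [hasDerivAt_iff_isLittleO]
    simp only [max_self, sub_zero, smul_zero, ne_eq, OfNat.ofNat_ne_zero, not_false_eq_true,
      zero_pow]
    have h1 : (fun r : ℝ => max 0 r ^ 2) =O[𝓝 0] fun r : ℝ => r ^ 2 := by
      refine Asymptotics.IsBigO.of_bound 1 (Eventually.of_forall fun s => ?_)
      rw [one_mul, norm_pow, norm_pow]
      gcongr
      rw [Real.norm_of_nonneg (le_max_left _ _)]
      exact max_le (norm_nonneg _) (le_abs_self _)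
    exact h1.trans_isLittleO (by
      simpa using Asymptotics.isLittleO_pow_pow (𝕜 := ℝ) (show 1 < 2 by norm_num))
  · have : (fun r : ℝ => max 0 r ^ 2) =ᶠ[𝓝 r] fun r => r ^ 2 := by
      filter_upwards [lt_mem_nhds h] with s hs
      simp [max_eq_right hs.le]
    rw [max_eq_right h.le]
    simpa using (hasDerivAt_pow 2 r).congr_of_eventuallyEq this

/-- The Moreau envelope whose gradient is the Yosida approximation. -/
def moreau (lam k : ℝ) (A : Sym3) : ℝ := max 0 (‖dev A‖ - k) ^ 2 / (4 * lam)

theorem hasFDerivAt_moreau {lam k : ℝ} (hlam : 0 < lam) (hk : 0 < k) (A : Sym3) :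
    HasFDerivAt (moreau lam k) (innerSL ℝ (yosida lam k A)) A := by
  -- The norm is not differentiable at `0`, but there the envelope vanishes in a whole neighbourhood
  -- because `k > 0`.
  by_cases hA : dev A = 0
  · have hev : moreau lam k =ᶠ[𝓝 A] fun _ => 0 := by
      have hc : Continuous fun B => ‖dev B‖ := devL.continuous.norm
      have : ∀ᶠ B in 𝓝 A, ‖dev B‖ < k :=
        hc.continuousAt.eventually_lt_const (by simpa [hA] using hk)
      filter_upwards [this] with B hB
      rw [moreau, max_eq_left (by linarith)]
      simp
    have hy : yosida lam k A = 0 := by simp [yosida, hA]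
    rw [hy, map_zero]
    exact (hasFDerivAt_const (0 : ℝ) A).congr_of_eventuallyEq hev
  · have hn : 0 < ‖dev A‖ := norm_pos_iff.2 hA
    have h1 : HasFDerivAt (fun B => ‖devL B‖ ^ 2) (2 • (innerSL ℝ (devL A)).comp devL) A :=
      devL.hasFDerivAt.norm_sq
    have h2 := h1.sqrt (by simpa using hA)
    have h3 : HasFDerivAt (fun B => ‖dev B‖)
        ((1 / (2 * ‖dev A‖)) • (2 • (innerSL ℝ (devL A)).comp devL)) A := by
      simpa [Real.sqrt_sq] using h2
    have h4 := ((hasDerivAt_max_zero_sq (‖dev A‖ - k)).div_const (4 * lam)).comp_hasFDerivAt A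
      (h3.sub_const k)
    have h5 : moreau lam k = (fun x => max 0 x ^ 2 / (4 * lam)) ∘ fun B => ‖dev B‖ - k := rfl
    rw [h5]
    refine h4.congr_fderiv (ContinuousLinearMap.ext fun B => ?_)
    simp only [innerSL_apply_apply, yosida, smul_apply, ContinuousLinearMap.comp_apply, devL_apply,
      sym_inner_smul_left, smul_eq_mul, nsmul_eq_mul, inner_dev_left]
    field_simp
    push_cast
    ring

theorem moreau_nonneg {lam : ℝ} (hlam : 0 < lam) (k : ℝ) (A : Sym3) : 0 ≤ moreau lam k A := by
  unfold moreau
  positivity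

theorem moreau_eq_zero (lam : ℝ) {k : ℝ} {A : Sym3} (hA : ‖dev A‖ ≤ k) : moreau lam k A = 0 := by
  rw [moreau, max_eq_left (by linarith)]
  simp

theorem hasFDerivAt_half_inner {V : Type*} [NormedAddCommGroup V] [InnerProductSpace ℝ V]
    {D : V →L[ℝ] V} (hD : (D : V →ₗ[ℝ] V).IsSymmetric) (A : V) :
    HasFDerivAt (fun A => inner ℝ (D A) A / 2) (innerSL ℝ (D A)) A := by
  have h := (D.hasFDerivAt (x := A)).inner ℝ (hasFDerivAt_id A)
  have h2 := h.mul_const (1 / 2 : ℝ)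
  refine (h2.congr_fderiv ?_).congr_of_eventuallyEq (Eventually.of_forall fun B => ?_)
  · ext B
    have h3 : inner ℝ (D B) A = inner ℝ (D A) B := by
      rw [real_inner_comm]
      exact (hD A B).symm
    simp [fderivInnerCLM_apply, h3]
    ring
  · simp only [id]
    ring

/-! ### The space `H¹₀(Ω)` -/

theorem tendsto_integral_inner {X E : Type*} [MeasurableSpace X] {μ : Measure X}
    [NormedAddCommGroup E] [InnerProductSpace ℝ E] {f g : X → E} {fn gn : ℕ → X → E}
    (hf : MemLp f 2 μ) (hg : MemLp g 2 μ) (hfn : ∀ n, MemLp (fn n) 2 μ)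
    (hgn : ∀ n, MemLp (gn n) 2 μ)
    (hflim : Tendsto (fun n => eLpNorm (fun x => f x - fn n x) 2 μ) atTop (𝓝 0))
    (hglim : Tendsto (fun n => eLpNorm (fun x => g x - gn n x) 2 μ) atTop (𝓝 0)) :
    Tendsto (fun n => ∫ x, inner ℝ (fn n x) (gn n x) ∂μ) atTop (𝓝 (∫ x, inner ℝ (f x) (g x) ∂μ)) := by
  have hin : ∀ {u v : X → E} (hu : MemLp u 2 μ) (hv : MemLp v 2 μ),
      ∫ x, inner ℝ (u x) (v x) ∂μ = inner ℝ (hu.toLp u) (hv.toLp v) := by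
    intro u v hu hv
    rw [L2.inner_def]
    refine integral_congr_ae ?_
    filter_upwards [hu.coeFn_toLp, hv.coeFn_toLp] with x h1 h2
    rw [h1, h2]
  have hlim : ∀ {u : X → E} {un : ℕ → X → E} (hu : MemLp u 2 μ) (hun : ∀ n, MemLp (un n) 2 μ),
      Tendsto (fun n => eLpNorm (fun x => u x - un n x) 2 μ) atTop (𝓝 0) →
      Tendsto (fun n => (hun n).toLp (un n)) atTop (𝓝 (hu.toLp u)) := by
    intro u un hu hun h
    rw [Lp.tendsto_Lp_iff_tendsto_eLpNorm'' _ hun _ hu]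
    refine h.congr fun n => ?_
    exact eLpNorm_sub_comm _ _ _ _
  simp only [hin hf hg, fun n => hin (hfn n) (hgn n)]
  exact (hlim hf hfn hflim).inner (hlim hg hgn hglim)

theorem continuous_jacobian {Ω : TopologicalSpace.Opens R3} (φ : 𝓓(Ω, R3)) :
    Continuous (jacobian φ) := by
  have h : Continuous (fderiv ℝ φ) :=
    (φ.contDiff.of_le (by simp : (1 : WithTop ℕ∞) ≤ _)).continuous_fderiv one_ne_zero
  refine (PiLp.continuous_toLp 2 _).comp (continuous_pi fun p => ?_)
  exact (EuclideanSpace.proj (𝕜 := ℝ) p.1).continuous.comp (h.clm_apply continuous_const)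

theorem hasCompactSupport_jacobian {Ω : TopologicalSpace.Opens R3} (φ : 𝓓(Ω, R3)) :
    HasCompactSupport (jacobian φ) := by
  refine (φ.hasCompactSupport.fderiv ℝ).mono fun x hx => ?_
  contrapose! hx
  simp only [Function.mem_support, not_not] at hx ⊢
  ext p
  simp [jacobian, hx]

theorem memLp_testFunction {Ω : TopologicalSpace.Opens R3} (φ : 𝓓(Ω, R3)) :
    MemLp φ 2 (spaceMeasure Ω) :=
  (φ.continuous.memLp_of_hasCompactSupport φ.hasCompactSupport).restrict _

theorem memLp_jacobian {Ω : TopologicalSpace.Opens R3} (φ : 𝓓(Ω, R3)) :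
    MemLp (jacobian φ) 2 (spaceMeasure Ω) :=
  ((continuous_jacobian φ).memLp_of_hasCompactSupport (hasCompactSupport_jacobian φ)).restrict _

/-- By density and continuity of the `L²` pairings, the distributional momentum balance may be
tested with `u_t`. -/
theorem InH10Vec.integral_inner_eq {Ω : TopologicalSpace.Opens R3} {w : R3 → R3} {G : R3 → Mat3}
    (h : InH10Vec Ω w G) {S : R3 → Mat3} {F : R3 → R3} (hS : MemLp S 2 (spaceMeasure Ω))
    (hF : MemLp F 2 (spaceMeasure Ω))
    (heq : ∀ φ : 𝓓(Ω, R3), ∫ x in (Ω : Set R3), inner ℝ (S x) (jacobian φ x) =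
      ∫ x in (Ω : Set R3), inner ℝ (F x) (φ x)) :
    ∫ x in (Ω : Set R3), inner ℝ (S x) (G x) = ∫ x in (Ω : Set R3), inner ℝ (F x) (w x) := by
  obtain ⟨φ, h1, h2⟩ := h.approx
  have l1 := tendsto_integral_inner hS h.grad_memLp (fun _ => hS) (fun n => memLp_jacobian (φ n))
    (by simp) h2
  have l2 := tendsto_integral_inner hF h.memLp (fun _ => hF) (fun n => memLp_testFunction (φ n))
    (by simp) h1
  simp only [heq] at l1
  exact tendsto_nhds_unique l1 l2

theorem integrable_sq_of_hasCompactSupport {v : R3 → ℝ} (hv : Continuous v)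
    (hc : HasCompactSupport v) : Integrable fun x => v x ^ 2 := by
  have hvs : HasCompactSupport fun x => v x ^ 2 := hc.comp_left (g := fun r : ℝ => r ^ 2) (by simp)
  have hvc : Continuous fun x => v x ^ 2 := hv.pow 2
  exact hvc.integrable_of_hasCompactSupport hvs

/-- Integrating by parts against the coordinate `x_i` gives `∫ v² = -∫ 2 x_i v ∂_i v ≤ ½ ∫ v² + 2 R²
∫ (∂_i v)²`, and half of the left side is absorbed. -/
theorem integral_sq_le_integral_partial_sq {v : R3 → ℝ} (hv : ContDiff ℝ 1 v)
    (hc : HasCompactSupport v) {R : ℝ} (hR : ∀ x, v x ≠ 0 → ‖x‖ ≤ R) (i : Fin 3) :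
    ∫ x, v x ^ 2 ≤ 4 * R ^ 2 * ∫ x, partialDeriv i v x ^ 2 := by
  have hd : Continuous (partialDeriv i v) :=
    (hv.continuous_fderiv one_ne_zero).clm_apply continuous_const
  have hds : HasCompactSupport (partialDeriv i v) :=
    hc.fderiv_apply (𝕜 := ℝ) (EuclideanSpace.single i 1)
  obtain ⟨π, hπi⟩ : ∃ π : R3 →L[ℝ] ℝ, ∀ x, π x = x i := ⟨EuclideanSpace.proj i, fun _ => rfl⟩
  have hsq : ∀ x, HasFDerivAt (fun x => v x ^ 2) ((2 * v x) • fderiv ℝ v x) x := by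
    intro x
    have := ((hv.differentiable one_ne_zero x).hasFDerivAt).pow 2
    simpa using this
  have hvs : HasCompactSupport fun x => v x ^ 2 := hc.comp_left (g := fun r : ℝ => r ^ 2) (by simp)
  have hfd : ∀ x, fderiv ℝ (fun x => v x ^ 2) x (EuclideanSpace.single i 1) =
      2 * v x * partialDeriv i v x := fun x => by
    rw [(hsq x).fderiv, smul_apply, smul_eq_mul, partialDeriv]
  have hvc : Continuous fun x => v x ^ 2 := hv.continuous.pow 2
  have hpc : ∀ x, fderiv ℝ π x (EuclideanSpace.single i 1) = 1 := fun x => by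
    rw [π.fderiv, hπi]; simp
  have i2 : Integrable fun x => v x ^ 2 := integrable_sq_of_hasCompactSupport hv.continuous hc
  have i3 : Integrable fun x => π x * (2 * v x * partialDeriv i v x) :=
    (π.continuous.mul ((continuous_const.mul hv.continuous).mul hd)).integrable_of_hasCompactSupport
      hds.mul_left.mul_left
  have h1 := integral_mul_fderiv_eq_neg_fderiv_mul_of_integrable (μ := (volume : Measure R3))
    (f := fun x => v x ^ 2) (g := π) (v := EuclideanSpace.single i 1)
    (by simp only [hfd]; simpa only [mul_comm] using i3)
    (by simpa only [hpc, mul_one] using i2)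
    ((hvc.mul π.continuous).integrable_of_hasCompactSupport hvs.mul_right)
    (fun x _ => (hsq x).differentiableAt) (fun x _ => π.differentiableAt)
  simp only [hpc, mul_one, hfd] at h1
  have i4 : Integrable fun x => partialDeriv i v x ^ 2 := integrable_sq_of_hasCompactSupport hd hds
  have h2 : ∫ x, v x ^ 2 ≤ ∫ x, (1 / 2 * v x ^ 2 + 2 * R ^ 2 * partialDeriv i v x ^ 2) := by
    rw [h1, ← integral_neg]
    have i5 : Integrable fun x => -(2 * v x * partialDeriv i v x * π x) :=
      i3.neg.congr (Eventually.of_forall fun x => by simp only [Pi.neg_apply]; ring)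
    refine integral_mono_ae i5
      ((i2.const_mul _).add (i4.const_mul _)) (Eventually.of_forall fun x => ?_)
    by_cases hx : v x = 0
    · simp only [hx]
      have := mul_nonneg (mul_nonneg zero_le_two (sq_nonneg R)) (sq_nonneg (partialDeriv i v x))
      simpa using this
    · have hπ : (π x) ^ 2 ≤ R ^ 2 := by
        have h3 : ‖x i‖ ≤ R := (PiLp.norm_apply_le x i).trans (hR x hx)
        rw [Real.norm_eq_abs] at h3
        rw [hπi]
        exact sq_le_sq' (abs_le.1 h3).1 (abs_le.1 h3).2
      have h4 := mul_le_mul_of_nonneg_right hπ (sq_nonneg (partialDeriv i v x))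
      nlinarith [sq_nonneg (v x + 2 * π x * partialDeriv i v x)]
  rw [integral_add (i2.const_mul _) (i4.const_mul _), integral_const_mul, integral_const_mul] at h2
  linarith

/-- The component `φ_i` is estimated through `∂_i φ_i` alone, so only diagonal entries of the
Jacobian occur and the symmetric gradient controls them. -/
theorem integral_norm_sq_testFunction_le {Ω : TopologicalSpace.Opens R3} {R : ℝ}
    (hR : (Ω : Set R3) ⊆ Metric.closedBall 0 R) (φ : 𝓓(Ω, R3)) :
    ∫ x in (Ω : Set R3), ‖φ x‖ ^ 2 ≤
      4 * R ^ 2 * ∫ x in (Ω : Set R3), ‖symPart (jacobian φ x)‖ ^ 2 := by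
  have hφ1 : ContDiff ℝ 1 φ := φ.contDiff.of_le (by simp)
  have h0 : ∀ x, x ∉ (Ω : Set R3) → φ x = 0 := fun x hx =>
    image_eq_zero_of_notMem_tsupport fun hm => hx (φ.tsupport_subset hm)
  have hj0 : ∀ x, x ∉ (Ω : Set R3) → jacobian φ x = 0 := fun x hx => by
    have : fderiv ℝ φ x = 0 := image_eq_zero_of_notMem_tsupport fun hm =>
      hx (φ.tsupport_subset (tsupport_fderiv_subset ℝ hm))
    ext p
    simp [jacobian, this]
  rw [setIntegral_eq_integral_of_forall_compl_eq_zero fun x hx => by simp [h0 x hx],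
    setIntegral_eq_integral_of_forall_compl_eq_zero fun x hx => by
      rw [hj0 x hx, ← symPartL_apply, map_zero]; simp]
  have hcomp : ∀ i, ContDiff ℝ 1 fun x => φ x i := fun i =>
    (EuclideanSpace.proj (𝕜 := ℝ) i).contDiff.comp hφ1
  have hcs : ∀ i, HasCompactSupport fun x => φ x i := fun i =>
    φ.hasCompactSupport.comp_left (g := fun v : R3 => v i) rfl
  have hpart : ∀ i x, partialDeriv i (fun x => φ x i) x = jacobian φ x (i, i) := by
    intro i x
    have h1 : HasFDerivAt (fun x => φ x i)
        ((EuclideanSpace.proj (𝕜 := ℝ) i).comp (fderiv ℝ φ x)) x :=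
      (EuclideanSpace.proj (𝕜 := ℝ) i).hasFDerivAt.comp x
        (hφ1.differentiable one_ne_zero x).hasFDerivAt
    rw [partialDeriv, h1.fderiv]
    rfl
  have hi : ∀ i, ∫ x, φ x i ^ 2 ≤ 4 * R ^ 2 * ∫ x, jacobian φ x (i, i) ^ 2 := by
    intro i
    have := integral_sq_le_integral_partial_sq (hcomp i) (hcs i) (R := R) (fun x hx => by
      have hxΩ : x ∈ (Ω : Set R3) := by
        by_contra hxn
        exact hx (by simp [h0 x hxn])
      simpa using hR hxΩ) i
    simpa only [hpart] using this
  have ij : Integrable fun x => ‖symPart (jacobian φ x)‖ ^ 2 := by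
    refine integrable_sq_of_hasCompactSupport
      ((symPartL.continuous.comp (continuous_jacobian φ)).norm) ?_
    refine (hasCompactSupport_jacobian φ).comp_left (g := fun A : Mat3 => ‖symPart A‖) ?_
    rw [← symPartL_apply, map_zero]; simp
  have i1 : ∀ i, Integrable fun x => φ x i ^ 2 := fun i =>
    integrable_sq_of_hasCompactSupport (hcomp i).continuous (hcs i)
  have i2 : ∀ i, Integrable fun x => jacobian φ x (i, i) ^ 2 := fun i =>
    integrable_sq_of_hasCompactSupport
      ((EuclideanSpace.proj (𝕜 := ℝ) (i, i)).continuous.comp (continuous_jacobian φ))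
      ((hasCompactSupport_jacobian φ).comp_left (g := fun A : Mat3 => A (i, i)) rfl)
  calc ∫ x, ‖φ x‖ ^ 2 = ∑ i, ∫ x, φ x i ^ 2 := by
        rw [← integral_finsetSum _ fun i _ => i1 i]
        simp only [EuclideanSpace.real_norm_sq_eq]
    _ ≤ ∑ i, 4 * R ^ 2 * ∫ x, jacobian φ x (i, i) ^ 2 := Finset.sum_le_sum fun i _ => hi i
    _ = 4 * R ^ 2 * ∫ x, ∑ i, jacobian φ x (i, i) ^ 2 := by
        rw [integral_finsetSum _ fun i _ => i2 i, Finset.mul_sum]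
    _ ≤ _ := by
        refine mul_le_mul_of_nonneg_left ?_ (by positivity)
        exact integral_mono (integrable_finsetSum _ fun i _ => i2 i) ij
          fun x => sum_diag_sq_le (jacobian φ x)

/-- Poincaré's inequality on `H¹₀(Ω; ℝ³)`, in terms of the symmetric gradient. -/
theorem InH10Vec.integral_norm_sq_le {Ω : TopologicalSpace.Opens R3} {R : ℝ}
    (hR : (Ω : Set R3) ⊆ Metric.closedBall 0 R) {w : R3 → R3} {G : R3 → Mat3}
    (h : InH10Vec Ω w G) :
    ∫ x in (Ω : Set R3), ‖w x‖ ^ 2 ≤ 4 * R ^ 2 * ∫ x in (Ω : Set R3), ‖symPart (G x)‖ ^ 2 := by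
  obtain ⟨φ, h1, h2⟩ := h.approx
  have hn := fun n => memLp_testFunction (φ n)
  have hjn := fun n => symPartL.comp_memLp' (memLp_jacobian (φ n))
  have hG := symPartL.comp_memLp' h.grad_memLp
  have h3 : Tendsto (fun n => eLpNorm (fun x => symPartL (G x) - symPartL (jacobian (φ n) x)) 2
      (spaceMeasure Ω)) atTop (𝓝 0) := by
    have h4 := ENNReal.Tendsto.const_mul (a := ENNReal.ofReal ‖symPartL‖) h2
      (Or.inr ENNReal.ofReal_ne_top)
    rw [mul_zero] at h4
    refine tendsto_of_tendsto_of_tendsto_of_le_of_le tendsto_const_nhds h4 (fun _ => zero_le)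
      fun n => ?_
    refine eLpNorm_le_mul_eLpNorm_of_ae_le_mul (Eventually.of_forall fun x => ?_) 2
    rw [← map_sub]
    exact symPartL.le_opNorm _
  have l1 := tendsto_integral_inner h.memLp h.memLp hn hn h1 h1
  have l2 := tendsto_integral_inner hG hG hjn hjn h3 h3
  simp only [real_inner_self_eq_norm_sq, Function.comp_def, symPartL_apply] at l1 l2
  exact le_of_tendsto_of_tendsto' l1 (l2.const_mul _)
    fun n => integral_norm_sq_testFunction_le hR (φ n)

/-! ### Joint measurability of the absolutely continuous representative -/

/-- Representatives in time are found for a.e. `x`, whereas the energy balance is stated for a.e.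
`t`. Joint measurability allows the two quantifiers to be exchanged. -/
theorem ae_prod_eq_of_ae_ae_eq {X Y V : Type*} [MeasurableSpace X] [MeasurableSpace Y]
    [NormedAddCommGroup V] {μ : Measure X} {ν : Measure Y} [SFinite ν] [SFinite μ] {f g : Y × X → V} (hf : AEStronglyMeasurable f (ν.prod μ))
    (hg : AEStronglyMeasurable g (ν.prod μ)) (h : ∀ᵐ x ∂μ, ∀ᵐ t ∂ν, f (t, x) = g (t, x)) :
    f =ᵐ[ν.prod μ] g := by
  have hswap : ∀ {p : Y × X → Prop}, (∀ᵐ z ∂ν.prod μ, p z) → ∀ᵐ x ∂μ, ∀ᵐ t ∂ν, p (t, x) :=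
    fun hp => Measure.ae_ae_of_ae_prod
      (Measure.measurePreserving_swap.quasiMeasurePreserving.ae hp)
  have h1 : ∀ᵐ x ∂μ, ∀ᵐ t ∂ν, hf.mk f (t, x) = hg.mk g (t, x) := by
    filter_upwards [h, hswap hf.ae_eq_mk, hswap hg.ae_eq_mk] with x h1 h2 h3
    filter_upwards [h1, h2, h3] with t h1 h2 h3
    rw [← h2, ← h3, h1]
  have hms : MeasurableSet {p : Y × X | hf.mk f p = hg.mk g p} :=
    hf.stronglyMeasurable_mk.measurableSet_eq_fun hg.stronglyMeasurable_mk
  have h2 := (Measure.ae_prod_iff_ae_ae hms).2 ((Measure.ae_ae_comm hms).2 h1)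
  exact hf.ae_eq_mk.trans (EventuallyEq.trans h2 hg.ae_eq_mk.symm)

section SpaceTime

variable {X V : Type*} [MeasurableSpace X] [NormedAddCommGroup V] [NormedSpace ℝ V]
  {μ : Measure X} {T : ℝ}

theorem aestronglyMeasurable_primitive [SFinite μ] {w₀ : X → V} {wt : ℝ → X → V}
    (hw₀ : AEStronglyMeasurable w₀ μ)
    (hwt : AEStronglyMeasurable (fun p : ℝ × X => wt p.1 p.2) ((timeMeasure T).prod μ)) :
    AEStronglyMeasurable (fun p : ℝ × X => primitive w₀ wt p.1 p.2) ((timeMeasure T).prod μ) := by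
  have h1 : AEStronglyMeasurable (fun q : (ℝ × X) × ℝ => wt q.2 q.1.2)
      (((timeMeasure T).prod μ).prod (timeMeasure T)) :=
    hwt.prod_swap.comp_quasiMeasurePreserving
      (QuasiMeasurePreserving.prodMap Measure.quasiMeasurePreserving_snd
        (Measure.QuasiMeasurePreserving.id _))
  -- The primitive becomes an integral over the fixed interval `(0, T)` with a parameter, the upper
  -- limit being moved into an indicator.
  have h2 : AEStronglyMeasurable
      ({q : (ℝ × X) × ℝ | q.2 ≤ q.1.1}.indicator fun q => wt q.2 q.1.2)
      (((timeMeasure T).prod μ).prod (timeMeasure T)) :=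
    h1.indicator (measurableSet_le measurable_snd (measurable_fst.comp measurable_fst))
  refine (hw₀.comp_quasiMeasurePreserving Measure.quasiMeasurePreserving_snd).add
    (h2.integral_prod_right'.congr ?_)
  have h3 : ∀ᵐ p ∂(timeMeasure T).prod μ, p.1 ∈ Ioo 0 T :=
    Measure.quasiMeasurePreserving_fst.ae (ae_restrict_mem measurableSet_Ioo)
  filter_upwards [h3] with p hp
  rw [intervalIntegral.integral_of_le hp.1.le]
  have h4 : (fun s => ({q : (ℝ × X) × ℝ | q.2 ≤ q.1.1}.indicator fun q => wt q.2 q.1.2) (p, s)) =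
      (Iic p.1).indicator fun s => wt s p.2 := by
    ext s
    by_cases hs : s ≤ p.1 <;> simp [indicator, hs]
  rw [h4, integral_indicator measurableSet_Iic, Measure.restrict_restrict measurableSet_Iic]
  congr 2
  ext s
  simp only [mem_inter_iff, mem_Iic, mem_Ioo, mem_Ioc]
  exact ⟨fun h => ⟨h.2.1, h.1⟩, fun h => ⟨h.2, h.1, h.2.trans_lt hp.2⟩⟩

theorem InH1TimeFrom.ae_eq_primitive_prod [IsFiniteMeasure μ] [CompleteSpace V] (hT : 0 < T)
    {w wt : ℝ → X → V} {w₀ : X → V} (h : InH1TimeFrom μ T w wt w₀)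
    (hw₀ : AEStronglyMeasurable w₀ μ) :
    ∀ᵐ t ∂timeMeasure T, ∀ᵐ x ∂μ, w t x = primitive w₀ wt t x :=
  Measure.ae_ae_of_ae_prod (ae_prod_eq_of_ae_ae_eq h.memL2.aestronglyMeasurable
    (aestronglyMeasurable_primitive hw₀ h.deriv_memL2.aestronglyMeasurable) (h.ae_eq_primitive hT))

end SpaceTime

/-! ### Grönwall's inequality in integral form -/

theorem integral_le_gronwallBound {T : ℝ} (hT : 0 ≤ T) {Z : ℝ → ℝ} (hZ : ContinuousOn Z (Icc 0 T))
    (h0 : ∀ t ∈ Icc 0 T, 0 ≤ Z t) {B K : ℝ}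
    (h : ∀ τ ∈ Icc 0 T, Z τ ≤ B + K * ∫ t in (0 : ℝ)..τ, Z t) :
    ∫ t in (0 : ℝ)..T, Z t ≤ gronwallBound 0 K B T := by
  -- Freezing `Z` outside `[0, T]` gives a continuous function on the line, whose primitive is
  -- differentiable everywhere, endpoints included.
  set Zc : ℝ → ℝ := fun t => Z (max 0 (min t T))
  have hproj : ∀ t : ℝ, max 0 (min t T) ∈ Icc 0 T := fun t =>
    ⟨le_max_left _ _, max_le hT (min_le_right _ _)⟩
  have hZc : Continuous Zc :=
    hZ.comp_continuous (continuous_const.max (continuous_id.min continuous_const)) hproj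
  have hZc0 : ∀ t, 0 ≤ Zc t := fun t => h0 _ (hproj t)
  have heq : ∀ τ ∈ Icc 0 T, ∫ t in (0 : ℝ)..τ, Z t = ∫ t in (0 : ℝ)..τ, Zc t := by
    intro τ hτ
    refine intervalIntegral.integral_congr fun t ht => ?_
    rw [uIcc_of_le hτ.1] at ht
    simp only [Zc, min_eq_left (ht.2.trans hτ.2), max_eq_right ht.1]
  have hd : ∀ t, HasDerivAt (fun τ => ∫ t in (0 : ℝ)..τ, Zc t) (Zc t) t := fun t =>
    intervalIntegral.integral_hasDerivAt_right (hZc.intervalIntegrable _ _)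
      (hZc.stronglyMeasurableAtFilter _ _) hZc.continuousAt
  have h1 := norm_le_gronwallBound_of_norm_deriv_right_le (f := fun τ => ∫ t in (0 : ℝ)..τ, Zc t)
    (f' := Zc) (δ := 0) (K := K) (ε := B) (a := 0) (b := T)
    (fun t _ => (hd t).continuousAt.continuousWithinAt) (fun t _ => (hd t).hasDerivWithinAt)
    (by simp) (fun t ht => ?_) T ⟨hT, le_rfl⟩
  · rw [heq T ⟨hT, le_rfl⟩]
    rw [sub_zero] at h1
    exact (le_abs_self _).trans h1
  · have ht' : t ∈ Icc 0 T := Ico_subset_Icc_self ht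
    have h2 := h t ht'
    rw [heq t ht'] at h2
    have h3 : Z t = Zc t := by
      simp only [Zc, min_eq_left ht'.2, max_eq_right ht'.1]
    rw [Real.norm_of_nonneg (hZc0 t),
      Real.norm_of_nonneg (intervalIntegral.integral_nonneg ht'.1 fun s _ => hZc0 s), ← h3]
    linarith

/-! ### The test function for the heat equation -/

/-- A smooth convex function comparable with the absolute value. -/
def smoothAbs (r : ℝ) : ℝ := √(1 + r ^ 2)

/-- The derivative of `smoothAbs`. -/
def smoothSign (r : ℝ) : ℝ := r / √(1 + r ^ 2)

theorem smoothAbs_pos (r : ℝ) : 0 < smoothAbs r := by unfold smoothAbs; positivity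

theorem smoothAbs_sq (r : ℝ) : smoothAbs r ^ 2 = 1 + r ^ 2 := Real.sq_sqrt (by positivity)

theorem abs_le_smoothAbs (r : ℝ) : |r| ≤ smoothAbs r :=
  Real.abs_le_sqrt (by linarith)

theorem one_le_smoothAbs (r : ℝ) : 1 ≤ smoothAbs r :=
  Real.one_le_sqrt.2 (by nlinarith [sq_nonneg r])

theorem smoothAbs_le (r : ℝ) : smoothAbs r ≤ 1 + |r| := by
  rw [smoothAbs, Real.sqrt_le_left (by positivity)]
  nlinarith [sq_abs r, abs_nonneg r]

theorem smoothSign_mul_smoothAbs (r : ℝ) : smoothSign r * smoothAbs r = r :=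
  div_mul_cancel₀ _ (smoothAbs_pos r).ne'

theorem abs_smoothSign_le (r : ℝ) : |smoothSign r| ≤ 1 := by
  rw [smoothSign, abs_div, abs_of_pos (show 0 < √(1 + r ^ 2) from smoothAbs_pos r)]
  exact div_le_one_of_le₀ (abs_le_smoothAbs r) (smoothAbs_pos r).le

theorem hasDerivAt_smoothAbs (r : ℝ) : HasDerivAt smoothAbs (smoothSign r) r := by
  have h : HasDerivAt (fun r : ℝ => 1 + r ^ 2) (2 * r) r := by
    simpa using (hasDerivAt_pow 2 r).const_add 1
  refine (h.sqrt (by positivity)).congr_deriv ?_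
  rw [smoothSign]
  field_simp

/-- The second derivative of `smoothAbs`. -/
def smoothSignDeriv (r : ℝ) : ℝ := (smoothAbs r ^ 3)⁻¹

theorem hasDerivAt_smoothSign (r : ℝ) : HasDerivAt smoothSign (smoothSignDeriv r) r := by
  have h := (hasDerivAt_id r).div (hasDerivAt_smoothAbs r) (smoothAbs_pos r).ne'
  refine h.congr_deriv ?_
  have h1 := smoothAbs_pos r
  have h2 := smoothSign_mul_smoothAbs r
  have h3 := smoothAbs_sq r
  rw [smoothSignDeriv, div_eq_iff (by positivity)]
  field_simp
  simp only [id]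
  linear_combination h3 - r * h2

theorem continuous_smoothAbs : Continuous smoothAbs := by unfold smoothAbs; fun_prop

theorem continuous_smoothSign : Continuous smoothSign :=
  continuous_iff_continuousAt.2 fun r => (hasDerivAt_smoothSign r).continuousAt

theorem continuous_smoothSignDeriv : Continuous smoothSignDeriv :=
  (continuous_smoothAbs.pow 3).inv₀ fun r => (pow_pos (smoothAbs_pos r) 3).ne'

theorem smoothSignDeriv_nonneg (r : ℝ) : 0 ≤ smoothSignDeriv r :=
  inv_nonneg.2 (pow_nonneg (smoothAbs_pos r).le 3)

theorem abs_smoothSignDeriv_le (r : ℝ) : |smoothSignDeriv r| ≤ 1 := by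
  rw [abs_of_nonneg (smoothSignDeriv_nonneg r)]
  exact inv_le_one_of_one_le₀ (one_le_pow₀ (one_le_smoothAbs r))

/-- Indeed `r (1 - η) ≤ √(1 + r²) (1 - η) = √(1 + r²) - r ≤ 1`. At positive temperatures this
compensates a linear growth of `f`. -/
theorem mul_one_sub_smoothSign_le {r : ℝ} (hr : 0 ≤ r) : r * (1 - smoothSign r) ≤ 1 := by
  have h1 := one_le_smoothAbs r
  have h2 := smoothAbs_sq r
  have h3 := smoothSign_mul_smoothAbs r
  have h4 : 0 ≤ smoothSign r := div_nonneg hr (smoothAbs_pos r).le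
  have h5 := abs_le_smoothAbs r
  rw [abs_of_nonneg hr] at h5
  have h6 : (1 - smoothSign r) * smoothAbs r = smoothAbs r - r := by linarith
  have h7 : 0 ≤ 1 - smoothSign r := by linarith [(abs_le.1 (abs_smoothSign_le r)).2]
  nlinarith

/-! ### The thermal term -/

theorem continuous_trunc (K : ℝ) : Continuous (trunc K) := by unfold trunc; fun_prop

theorem abs_trunc_le_abs {K : ℝ} (hK : 0 ≤ K) (r : ℝ) : |trunc K r| ≤ |r| :=
  abs_le.2 ⟨le_min (by linarith [abs_nonneg r]) ((neg_abs_le r).trans (le_max_left _ _)),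
    (min_le_right _ _).trans (max_le (le_abs_self r) (by linarith [abs_nonneg r]))⟩

theorem abs_trunc_le {K : ℝ} (hK : 0 ≤ K) (r : ℝ) : |trunc K r| ≤ K :=
  abs_le.2 ⟨le_min (by linarith) (le_max_right _ _), min_le_left _ _⟩

theorem trunc_nonneg {K : ℝ} (hK : 0 ≤ K) {r : ℝ} (hr : 0 ≤ r) : 0 ≤ trunc K r :=
  le_min hK (hr.trans (le_max_left _ _))

theorem trunc_le_self {K : ℝ} (hK : 0 ≤ K) {r : ℝ} (hr : 0 ≤ r) : trunc K r ≤ r :=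
  (min_le_right _ _).trans (max_le le_rfl (by linarith))

theorem trunc_neg_of_neg {K : ℝ} (hK : 0 < K) {r : ℝ} (hr : r < 0) : trunc K r < 0 :=
  (min_le_right _ _).trans_lt (max_lt hr (by linarith))

theorem abs_le_affine_of_growth {f : ℝ → ℝ} {a M α : ℝ} (hM : 0 ≤ M)
    (hα : α ∈ Ioo (1 / 2 : ℝ) (5 / 6)) (h : ∀ r : ℝ, |f r| ≤ a + M * |r| ^ α) (r : ℝ) :
    |f r| ≤ a + M * (1 + |r|) := by
  refine (h r).trans ?_
  gcongr
  have h1 : |r| ^ α ≤ (1 + |r|) ^ α :=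
    Real.rpow_le_rpow (abs_nonneg r) (by linarith) (by linarith [hα.1])
  refine h1.trans ?_
  conv_rhs => rw [← Real.rpow_one (1 + |r|)]
  exact Real.rpow_le_rpow_of_exponent_le (by linarith [abs_nonneg r]) (by linarith [hα.2])

/-- The right side is linear in `|r|` because the energy estimate controls the temperature `r` only
in `L¹`; the known function `ρ` may appear squared. The constant does not see the truncation height
`L`. -/
theorem exists_thermal_bound {f : ℝ → ℝ}
    (hf_growth : ∃ a M α : ℝ, 0 ≤ a ∧ 0 ≤ M ∧ α ∈ Ioo (1 / 2 : ℝ) (5 / 6) ∧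
      ∀ r : ℝ, |f r| ≤ a + M * |r| ^ α)
    (hf_neg : ∃ C : ℝ, 0 < C ∧ ∀ r : ℝ, r < 0 → |f r| ≤ C * (1 + |r|) ^ (1 / 2 : ℝ)) :
    ∃ K : ℝ, 0 ≤ K ∧ ∀ L : ℝ, 0 < L → ∀ r ρ : ℝ,
      (f (trunc L (r + ρ)) * (1 - smoothSign r)) ^ 2 ≤ K * (1 + |r| + ρ ^ 2) := by
  obtain ⟨a, M, α, ha, hM, hα, hfα⟩ := hf_growth
  obtain ⟨C, hC, hfC⟩ := hf_neg
  refine ⟨8 * (a + 2 * M) ^ 2 + 8 * M ^ 2 + 8 * C ^ 2, by positivity, fun L hL r ρ => ?_⟩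
  set z := trunc L (r + ρ)
  have hz : |z| ≤ |r| + |ρ| := (abs_trunc_le_abs hL.le _).trans (abs_add_le r ρ)
  have hfz : |f z| ≤ a + M * (1 + |z|) := abs_le_affine_of_growth hM hα hfα z
  have hη := abs_le.1 (abs_smoothSign_le r)
  have hη0 : 0 ≤ 1 - smoothSign r := by linarith [hη.2]
  have hη2 : 1 - smoothSign r ≤ 2 := by linarith [hη.1]
  have hr0 := abs_nonneg r
  have hρ2 : |ρ| ≤ 1 + ρ ^ 2 := by nlinarith [sq_abs ρ, abs_nonneg ρ]
  -- both regimes reduce to a bound by an affine function of `|ρ|`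
  have hfin : |f z * (1 - smoothSign r)| ≤ 2 * (a + 2 * M + M * |ρ|) →
      (f z * (1 - smoothSign r)) ^ 2 ≤
        (8 * (a + 2 * M) ^ 2 + 8 * M ^ 2 + 8 * C ^ 2) * (1 + |r| + ρ ^ 2) := by
    intro h
    have h1 := pow_le_pow_left₀ (abs_nonneg _) h 2
    rw [sq_abs] at h1
    refine h1.trans ?_
    have h2 : (2 * (a + 2 * M + M * |ρ|)) ^ 2 ≤ 8 * (a + 2 * M) ^ 2 + 8 * M ^ 2 * ρ ^ 2 := by
      rw [← sq_abs ρ]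
      nlinarith [sq_nonneg (a + 2 * M - M * |ρ|)]
    have h3 : 0 ≤ (8 * (a + 2 * M) ^ 2) * (|r| + ρ ^ 2) := by positivity
    have h4 : 0 ≤ (8 * M ^ 2) * (1 + |r|) := by positivity
    have h5 : 0 ≤ (8 * C ^ 2) * (1 + |r| + ρ ^ 2) := by positivity
    nlinarith
  rcases le_or_gt 0 r with hr | hr
  · refine hfin ?_
    have h1 := mul_one_sub_smoothSign_le hr
    have h2 : 1 - smoothSign r ≤ 1 := by
      have : 0 ≤ smoothSign r := div_nonneg hr (smoothAbs_pos r).le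
      linarith
    rw [abs_mul, abs_of_nonneg hη0]
    rw [abs_of_nonneg hr] at hz
    calc |f z| * (1 - smoothSign r) ≤ (a + M * (1 + (r + |ρ|))) * (1 - smoothSign r) := by
          gcongr
          exact hfz.trans (by gcongr)
      _ = (a + M + M * |ρ|) * (1 - smoothSign r) + M * (r * (1 - smoothSign r)) := by ring
      _ ≤ (a + M + M * |ρ|) * 1 + M * 1 := by gcongr
      _ ≤ _ := by nlinarith [abs_nonneg ρ, mul_nonneg hM (abs_nonneg ρ)]
  -- For `r < 0` the factor `1 - η` is merely at most `2`. If the argument `z` of `f` is negative,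
  -- its square root growth makes `f²` linear in `|z|`.
  · rcases lt_or_ge z 0 with hz0 | hz0
    · have h1 := hfC z hz0
      have h2 : |f z| ^ 2 ≤ C ^ 2 * (1 + |z|) := by
        refine (pow_le_pow_left₀ (abs_nonneg _) h1 2).trans_eq ?_
        rw [mul_pow, ← Real.sqrt_eq_rpow, Real.sq_sqrt (by positivity)]
      rw [mul_pow, ← sq_abs (f z)]
      have h3 : (1 - smoothSign r) ^ 2 ≤ 4 := by nlinarith
      calc |f z| ^ 2 * (1 - smoothSign r) ^ 2 ≤ (C ^ 2 * (1 + (|r| + |ρ|))) * 4 := by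
            gcongr
            exact h2.trans (by gcongr)
        _ ≤ 8 * C ^ 2 * (1 + |r| + ρ ^ 2) := by nlinarith [sq_nonneg C]
        _ ≤ _ := by
            gcongr
            nlinarith [sq_nonneg (a + 2 * M), sq_nonneg M]
    -- Here `r < 0 ≤ r + ρ`, so `0 ≤ z ≤ ρ` and the affine bound on `f` involves `ρ` only.
    · refine hfin ?_
      have h1 : 0 ≤ r + ρ := by
        by_contra! h
        exact absurd (trunc_neg_of_neg hL h) (not_lt.2 hz0)
      have h2 : z ≤ r + ρ := trunc_le_self hL.le h1
      have h3 : |z| ≤ |ρ| := by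
        rw [abs_of_nonneg hz0]
        linarith [le_abs_self ρ]
      rw [abs_mul, abs_of_nonneg hη0]
      calc |f z| * (1 - smoothSign r) ≤ (a + M * (1 + |ρ|)) * 2 := by
            gcongr
            exact hfz.trans (by gcongr)
        _ ≤ _ := by nlinarith [abs_nonneg ρ]

/-! ### The energy inequality -/

theorem integrable_inner_of_memLp {X E : Type*} [MeasurableSpace X] {μ : Measure X}
    [NormedAddCommGroup E] [InnerProductSpace ℝ E] {f g : X → E} (hf : MemLp f 2 μ)
    (hg : MemLp g 2 μ) : Integrable (fun x => (inner ℝ (f x) (g x) : ℝ)) μ := by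
  refine (L2.integrable_inner (𝕜 := ℝ) (hf.toLp f) (hg.toLp g)).congr ?_
  filter_upwards [hf.coeFn_toLp, hg.coeFn_toLp] with x h1 h2
  rw [h1, h2]

theorem integrable_norm_sq_of_memLp {X E : Type*} [MeasurableSpace X] {μ : Measure X}
    [NormedAddCommGroup E] {f : X → E} (hf : MemLp f 2 μ) : Integrable (fun x => ‖f x‖ ^ 2) μ :=
  (memLp_two_iff_integrable_sq_norm hf.aestronglyMeasurable).1 hf

theorem tr_sq_le (A : Sym3) : tr (A : Mat3) ^ 2 ≤ 3 * ‖A‖ ^ 2 := by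
  have h1 : ‖idMat‖ ^ 2 = 3 := by
    rw [← real_inner_self_eq_norm_sq, inner_idMat, tr_idMat]
  have h2 := abs_real_inner_le_norm A idMat
  rw [inner_idMat] at h2
  rw [← sq_abs, ← h1, mul_comm, ← mul_pow]
  exact pow_le_pow_left₀ (abs_nonneg _) h2 2

theorem mul_le_young {δ : ℝ} (hδ : 0 < δ) (a b : ℝ) : a * b ≤ a ^ 2 / (4 * δ) + δ * b ^ 2 := by
  have h : a ^ 2 / (4 * δ) + δ * b ^ 2 - a * b = (a - 2 * δ * b) ^ 2 / (4 * δ) := by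
    field_simp
    ring
  have : 0 ≤ (a - 2 * δ * b) ^ 2 / (4 * δ) := by positivity
  linarith

/-- The balance at a fixed time: `S` is the stress, `ε` the strain rate, `p` the plastic strain
rate, `u` the velocity, `fh` the thermal term, `m` the truncated heating. Adding the two tested
equations leaves three terms to estimate: `m η - S : p ≤ 0`, the coupling `fh (1 - η) tr ε`, and the
load. The last two each consume a quarter of `∫ D ε : ε`, so that half of it remains. -/
theorem energy_inequality {X : Type*} [MeasurableSpace X] {μ : Measure X} [IsFiniteMeasure μ]
    {D : Sym3 →L[ℝ] Sym3} {c R K : ℝ} (hc : 0 < c) (hD : ∀ A, c * ‖A‖ ^ 2 ≤ inner ℝ (D A) A)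
    (hR : 0 < R) {S ε p : X → Sym3} {F u : X → R3} {θ θt ρ fh m : X → ℝ}
    (hS : MemLp S 2 μ) (hε : MemLp ε 2 μ) (hp : MemLp p 2 μ) (hF : MemLp F 2 μ) (hu : MemLp u 2 μ)
    (hθ : MemLp θ 2 μ) (hρ : MemLp ρ 2 μ) (hfh : MemLp fh 2 μ)
    (hmm : AEStronglyMeasurable m μ)
    (hm : ∀ᵐ x ∂μ, 0 ≤ m x ∧ m x ≤ inner ℝ (p x) (S x))
    (hmom : ∫ x, inner ℝ (S x - fh x • idMat + D (ε x)) (ε x) ∂μ = ∫ x, inner ℝ (F x) (u x) ∂μ)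
    (hheat : ∫ x, θt x * smoothSign (θ x) ∂μ ≤
      ∫ x, (-(fh x * tr (ε x)) + m x) * smoothSign (θ x) ∂μ)
    (hpo : ∫ x, ‖u x‖ ^ 2 ∂μ ≤ 4 * R ^ 2 * ∫ x, ‖ε x‖ ^ 2 ∂μ)
    (hth : ∀ᵐ x ∂μ, (fh x * (1 - smoothSign (θ x))) ^ 2 ≤ K * (1 + |θ x| + ρ x ^ 2)) :
    ∫ x, inner ℝ (S x) (ε x - p x) ∂μ + ∫ x, θt x * smoothSign (θ x) ∂μ +
        1 / 2 * ∫ x, inner ℝ (D (ε x)) (ε x) ∂μ ≤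
      4 * R ^ 2 / c * ∫ x, ‖F x‖ ^ 2 ∂μ + 3 * K / c * ∫ x, (1 + |θ x| + ρ x ^ 2) ∂μ := by
  have hη : AEStronglyMeasurable (fun x => smoothSign (θ x)) μ :=
    continuous_smoothSign.comp_aestronglyMeasurable hθ.aestronglyMeasurable
  have hηb : ∀ᵐ x ∂μ, ‖smoothSign (θ x)‖ ≤ 1 := Eventually.of_forall fun x => abs_smoothSign_le _
  have htr : MemLp (fun x => tr (ε x)) 2 μ := by
    refine MemLp.congr_norm (f := fun x => innerSL ℝ idMat (ε x)) ((innerSL ℝ idMat).comp_memLp' hε)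
      ?_ (Eventually.of_forall fun x => ?_)
    · refine ((innerSL ℝ idMat).comp_memLp' hε).aestronglyMeasurable.congr
        (Eventually.of_forall fun x => ?_)
      simp only [Function.comp_apply, innerSL_apply_apply]
      rw [real_inner_comm, inner_idMat]
    · rw [innerSL_apply_apply, real_inner_comm, inner_idMat]
  have iSε := integrable_inner_of_memLp hS hε
  have ipS := integrable_inner_of_memLp hp hS
  have iFu := integrable_inner_of_memLp hF hu
  have iF := integrable_norm_sq_of_memLp hF
  have iu := integrable_norm_sq_of_memLp hu
  have iε := integrable_norm_sq_of_memLp hε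
  have ift : Integrable (fun x => fh x * tr (ε x)) μ := hfh.integrable_mul htr
  have iθ : Integrable (fun x => 1 + |θ x| + ρ x ^ 2) μ :=
    ((integrable_const 1).add (hθ.integrable (by norm_num)).abs).add hρ.integrable_sq
  have im : Integrable m μ := by
    refine ipS.mono' hmm ?_
    filter_upwards [hm] with x hx
    rw [Real.norm_of_nonneg hx.1]
    exact hx.2
  have iSp : Integrable (fun x => (inner ℝ (S x) (p x) : ℝ)) μ := integrable_inner_of_memLp hS hp
  have iq : Integrable (fun x => (inner ℝ (D (ε x)) (ε x) : ℝ)) μ :=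
    integrable_inner_of_memLp (D.comp_memLp' hε) hε
  have ifη : Integrable (fun x => fh x * tr (ε x) * smoothSign (θ x)) μ := ift.mul_bdd hη hηb
  have imη : Integrable (fun x => m x * smoothSign (θ x)) μ := im.mul_bdd hη hηb
  have emom : ∀ x, inner ℝ (S x - fh x • idMat + D (ε x)) (ε x) =
      inner ℝ (S x) (ε x) - fh x * tr (ε x) + inner ℝ (D (ε x)) (ε x) := by
    intro x
    rw [inner_add_left, inner_sub_left, sym_inner_smul_left, real_inner_comm (ε x) idMat,
      inner_idMat]
  have hmom' : ∫ x, inner ℝ (S x) (ε x) ∂μ - ∫ x, fh x * tr (ε x) ∂μ +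
      ∫ x, inner ℝ (D (ε x)) (ε x) ∂μ = ∫ x, inner ℝ (F x) (u x) ∂μ := by
    have iSf : Integrable (fun x => inner ℝ (S x) (ε x) - fh x * tr (ε x)) μ := iSε.sub ift
    rw [← hmom, ← integral_sub iSε ift, ← integral_add iSf iq]
    simp only [emom]
  have hheat' : ∫ x, θt x * smoothSign (θ x) ∂μ ≤
      -∫ x, fh x * tr (ε x) * smoothSign (θ x) ∂μ + ∫ x, m x * smoothSign (θ x) ∂μ := by
    refine hheat.trans_eq ?_
    rw [← integral_neg, ← integral_add (f := fun x => -(fh x * tr (ε x) * smoothSign (θ x)))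
      ifη.neg imη]
    simp only [add_mul, neg_mul]
  -- With the Poincaré constant, `δ * 4 * R ^ 2 = c / 4`, so the load costs one quarter of the
  -- dissipation.
  set δ : ℝ := c / (16 * R ^ 2) with hδ
  have hδ0 : 0 < δ := by positivity
  have b1 : ∫ x, m x * smoothSign (θ x) ∂μ ≤ ∫ x, inner ℝ (S x) (p x) ∂μ := by
    refine integral_mono_ae imη iSp ?_
    filter_upwards [hm] with x hx
    rw [real_inner_comm]
    exact (mul_le_of_le_one_right hx.1 (abs_le.1 (abs_smoothSign_le (θ x))).2).trans hx.2
  have b2 : ∫ x, fh x * tr (ε x) ∂μ - ∫ x, fh x * tr (ε x) * smoothSign (θ x) ∂μ ≤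
      3 * K / c * ∫ x, (1 + |θ x| + ρ x ^ 2) ∂μ + 1 / 4 * ∫ x, inner ℝ (D (ε x)) (ε x) ∂μ := by
    rw [← integral_sub ift ifη, ← integral_const_mul, ← integral_const_mul,
      ← integral_add (iθ.const_mul _) (iq.const_mul _)]
    refine integral_mono_ae (ift.sub ifη) ((iθ.const_mul _).add (iq.const_mul _)) ?_
    filter_upwards [hth] with x hthx
    -- Since `(tr ε)² ≤ 3 |ε|²`, the weight `c / 12` yields `c / 4 * |ε|²`, again one quarter of the
    -- dissipation.
    have h3 := mul_le_young (show 0 < c / 12 by positivity)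
      (fh x * (1 - smoothSign (θ x))) (tr (ε x))
    have h4 := tr_sq_le (ε x)
    have h5 := hD (ε x)
    have h6 : (fh x * (1 - smoothSign (θ x))) ^ 2 / (4 * (c / 12)) ≤
        3 * K / c * (1 + |θ x| + ρ x ^ 2) := by
      rw [show 4 * (c / 12) = c / 3 by ring, div_le_iff₀ (by positivity)]
      refine hthx.trans_eq ?_
      field_simp
    nlinarith
  have b3 : ∫ x, inner ℝ (F x) (u x) ∂μ ≤
      4 * R ^ 2 / c * ∫ x, ‖F x‖ ^ 2 ∂μ + δ * ∫ x, ‖u x‖ ^ 2 ∂μ := by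
    rw [← integral_const_mul, ← integral_const_mul,
      ← integral_add (iF.const_mul _) (iu.const_mul _)]
    refine integral_mono iFu ((iF.const_mul _).add (iu.const_mul _)) fun x => ?_
    refine (real_inner_le_norm _ _).trans ((mul_le_young hδ0 _ _).trans_eq ?_)
    rw [hδ]
    field_simp
    ring
  have b4 : δ * ∫ x, ‖u x‖ ^ 2 ∂μ ≤ 1 / 4 * ∫ x, inner ℝ (D (ε x)) (ε x) ∂μ := by
    have h9 : c * ∫ x, ‖ε x‖ ^ 2 ∂μ ≤ ∫ x, inner ℝ (D (ε x)) (ε x) ∂μ := by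
      rw [← integral_const_mul]
      exact integral_mono (iε.const_mul c) iq fun x => hD (ε x)
    calc δ * ∫ x, ‖u x‖ ^ 2 ∂μ ≤ δ * (4 * R ^ 2 * ∫ x, ‖ε x‖ ^ 2 ∂μ) := by gcongr
      _ = 1 / 4 * (c * ∫ x, ‖ε x‖ ^ 2 ∂μ) := by
          rw [hδ]
          field_simp
          ring
      _ ≤ _ := by gcongr
  simp only [inner_sub_right]
  rw [integral_sub iSε iSp]
  linarith

/-! ### Estimates for the approximate solutions -/

/-- The elastic strain `ε(u) - ε^p`. -/
def Fields.strain (s : Fields) (t : ℝ) (x : R3) : Sym3 := symPart (s.gradU t x) - s.ep t x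

/-- The time derivative of the elastic strain. -/
def Fields.strainDeriv (s : Fields) (t : ℝ) (x : R3) : Sym3 := symPart (s.gradUt t x) - s.ept t x

section Approx

variable {Ω : TopologicalSpace.Opens R3} {T k : ℝ} {D : Sym3 →ₗ[ℝ] Sym3} {f : ℝ → ℝ}
  {F : ℝ → R3 → R3} {u₀ : R3 → R3} {gradU₀ : R3 → Mat3} {ep₀ : R3 → Sym3} {θ₀ : R3 → ℝ}
  {θtil : ℝ → R3 → ℝ} {lam : ℝ} {s : Fields}

theorem isFiniteMeasure_spaceMeasure (hΩ : Bornology.IsBounded (Ω : Set R3)) :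
    IsFiniteMeasure (spaceMeasure Ω) := ⟨by simpa using hΩ.measure_lt_top⟩

theorem IsApproxSolution.strain_time [IsFiniteMeasure (spaceMeasure Ω)]
    (h : IsApproxSolution Ω T D k f F u₀ gradU₀ ep₀ θ₀ θtil lam s) :
    InH1TimeFrom (spaceMeasure Ω) T s.strain s.strainDeriv
      (fun x => symPart (gradU₀ x) - ep₀ x) :=
  (h.gradU_time.clm symPartL).sub h.ep_time

theorem IsApproxSolution.ae_ept_eq
    (h : IsApproxSolution Ω T D k f F u₀ gradU₀ ep₀ θ₀ θtil lam s) :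
    ∀ᵐ p ∂(timeMeasure T).prod (spaceMeasure Ω),
      s.ept p.1 p.2 = yosida lam k (D (s.strain p.1 p.2)) := by
  filter_upwards [h.flow_rule, h.stress_eq] with p h1 h2
  rw [h1, h2]
  rfl

/-- The truncation makes the thermal term bounded. The bound depends on `lam` and serves only to
make the integrals finite. -/
theorem memLp_thermal [IsFiniteMeasure (spaceMeasure Ω)] (hf : Continuous f) (hlam : 0 < lam)
    {θ : ℝ → R3 → ℝ} {t : ℝ} (hθ : MemLp (θ t) 2 (spaceMeasure Ω))
    (hθtil : MemLp (θtil t) 2 (spaceMeasure Ω)) :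
    MemLp (thermal f lam θ θtil t) 2 (spaceMeasure Ω) := by
  have hL : 0 ≤ 1 / lam := by positivity
  obtain ⟨B, hB⟩ := (isCompact_Icc (a := -(1 / lam)) (b := 1 / lam)).exists_bound_of_continuousOn
    hf.continuousOn
  refine MemLp.of_bound ?_ B (Eventually.of_forall fun x => ?_)
  · exact (hf.comp (continuous_trunc _)).comp_aestronglyMeasurable
      (hθ.aestronglyMeasurable.add hθtil.aestronglyMeasurable)
  · exact hB _ (abs_le.1 (abs_trunc_le hL _))

/-- The chain rule makes `η(θ)` an admissible test function; the diffusion term `η'(θ) |∇θ|²` is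
nonnegative and is dropped. -/
theorem IsApproxSolution.heat_smoothSign (hΩ : Bornology.IsBounded (Ω : Set R3))
    (h : IsApproxSolution Ω T D k f F u₀ gradU₀ ep₀ θ₀ θtil lam s) :
    ∀ᵐ t ∂timeMeasure T, ∫ x in (Ω : Set R3), s.θt t x * smoothSign (s.θ t x) ≤
      ∫ x in (Ω : Set R3), (-(thermal f lam s.θ θtil t x * tr (symPart (s.gradUt t x) : Mat3)) +
        trunc (1 / lam) (inner ℝ (s.ept t x) (s.stress t x))) * smoothSign (s.θ t x) := by
  have := isFiniteMeasure_spaceMeasure hΩ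
  filter_upwards [h.heat, h.θ_space, h.θ_time.deriv_memL2.ae_memLp] with t ht hθ hθt
  have hφ : InH1 Ω (fun x => smoothSign (s.θ t x))
      (fun x => smoothSignDeriv (s.θ t x) • s.gradθ t x) :=
    hθ.comp hΩ hasDerivAt_smoothSign continuous_smoothSignDeriv abs_smoothSign_le
      abs_smoothSignDeriv_le
  have h1 := ht _ _ hφ
  simp only [tr_symPart]
  rw [← h1]
  have i1 : Integrable (fun x => s.θt t x * smoothSign (s.θ t x)) (spaceMeasure Ω) :=
    hθt.integrable_mul hφ.memLp
  refine integral_mono i1 (i1.add (integrable_inner_of_memLp hθ.grad_memLp hφ.grad_memLp))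
    fun x => ?_
  simp only [real_inner_smul_right, real_inner_self_eq_norm_sq]
  have := mul_nonneg (smoothSignDeriv_nonneg (s.θ t x)) (sq_nonneg ‖s.gradθ t x‖)
  linarith

theorem IsApproxSolution.momentum_ut [IsFiniteMeasure (spaceMeasure Ω)] (hf : Continuous f)
    (hlam : 0 < lam) (hF : MemL2L2 (spaceMeasure Ω) T F) (hθtil : MemL2L2 (spaceMeasure Ω) T θtil)
    (h : IsApproxSolution Ω T D k f F u₀ gradU₀ ep₀ θ₀ θtil lam s) :
    ∀ᵐ t ∂timeMeasure T, ∫ x in (Ω : Set R3),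
        inner ℝ (D (s.strain t x) - thermal f lam s.θ θtil t x • idMat +
          D (symPart (s.gradUt t x))) (symPart (s.gradUt t x)) =
      ∫ x in (Ω : Set R3), inner ℝ (F t x) (s.ut t x) := by
  filter_upwards [h.momentum, h.ut_space, h.strain_time.memL2.ae_memLp, hF.ae_memLp,
    h.θ_time.memL2.ae_memLp, hθtil.ae_memLp] with t hmom hut hA hFt hθ hθt
  have hth := memLp_thermal hf hlam hθ hθt
  have hthid : MemLp (fun x => thermal f lam s.θ θtil t x • idMat) 2 (spaceMeasure Ω) :=
    (ContinuousLinearMap.toSpanSingleton ℝ idMat).comp_memLp' hth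
  have hS : MemLp (fun x => D (s.strain t x) - thermal f lam s.θ θtil t x • idMat +
      D (symPart (s.gradUt t x))) 2 (spaceMeasure Ω) :=
    ((D.toContinuousLinearMap.comp_memLp' hA).sub hthid).add
      ((D.toContinuousLinearMap.comp symPartL).comp_memLp' hut.grad_memLp)
  have h1 := hut.integral_inner_eq (Sym3.subtypeL.comp_memLp' hS) hFt hmom
  rw [← h1]
  refine integral_congr_ae (Eventually.of_forall fun x => ?_)
  exact (inner_coe_eq_inner_symPart _ _).symm

theorem IsApproxSolution.ae_energy_inequality (hΩ : Bornology.IsBounded (Ω : Set R3)) {c R K : ℝ}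
    (hR : 0 < R) (hΩR : (Ω : Set R3) ⊆ Metric.closedBall 0 R) (hc : 0 < c)
    (hD : ∀ A, c * ‖A‖ ^ 2 ≤ inner ℝ (D A) A) (hf : Continuous f)
    (hK : ∀ L : ℝ, 0 < L → ∀ r ρ : ℝ,
      (f (trunc L (r + ρ)) * (1 - smoothSign r)) ^ 2 ≤ K * (1 + |r| + ρ ^ 2))
    (hlam : 0 < lam) (hF : MemL2L2 (spaceMeasure Ω) T F) (hθtil : MemL2L2 (spaceMeasure Ω) T θtil)
    (h : IsApproxSolution Ω T D k f F u₀ gradU₀ ep₀ θ₀ θtil lam s) :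
    ∀ᵐ t ∂timeMeasure T,
      ∫ x, inner ℝ (D (s.strain t x)) (s.strainDeriv t x) ∂spaceMeasure Ω +
        ∫ x, s.θt t x * smoothSign (s.θ t x) ∂spaceMeasure Ω +
        1 / 2 * ∫ x, inner ℝ (D (symPart (s.gradUt t x))) (symPart (s.gradUt t x)) ∂spaceMeasure Ω ≤
      4 * R ^ 2 / c * ∫ x, ‖F t x‖ ^ 2 ∂spaceMeasure Ω +
        3 * K / c * ∫ x, (1 + |s.θ t x| + θtil t x ^ 2) ∂spaceMeasure Ω := by
  have := isFiniteMeasure_spaceMeasure hΩ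
  filter_upwards [h.heat_smoothSign hΩ, h.momentum_ut hf hlam hF hθtil, h.ut_space,
    h.strain_time.memL2.ae_memLp, hF.ae_memLp, h.θ_time.memL2.ae_memLp, hθtil.ae_memLp,
    h.ep_time.deriv_memL2.ae_memLp, Measure.ae_ae_of_ae_prod h.ae_ept_eq,
    Measure.ae_ae_of_ae_prod h.stress_eq] with t hheat hmom hut hA hFt hθ hθt hept hflow hstress
  have hL : 0 < 1 / lam := by positivity
  have hS : MemLp (fun x => D (s.strain t x)) 2 (spaceMeasure Ω) :=
    D.toContinuousLinearMap.comp_memLp' hA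
  have hstress' : ∀ᵐ x ∂spaceMeasure Ω, s.stress t x = D (s.strain t x) := hstress
  refine energy_inequality (D := D.toContinuousLinearMap) (ε := fun x => symPart (s.gradUt t x))
    (p := s.ept t) (m := fun x => trunc (1 / lam) (inner ℝ (s.ept t x) (s.stress t x)))
    (fh := thermal f lam s.θ θtil t) hc hD hR hS (symPartL.comp_memLp' hut.grad_memLp) hept hFt
    hut.memLp hθ hθt (memLp_thermal hf hlam hθ hθt) ?_ ?_ hmom hheat
    (hut.integral_norm_sq_le hΩR) (Eventually.of_forall fun x => hK _ hL _ _)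
  · refine (continuous_trunc _).comp_aestronglyMeasurable
      ((hept.aestronglyMeasurable.inner hS.aestronglyMeasurable).congr ?_)
    filter_upwards [hstress'] with x hx
    rw [hx]
  · filter_upwards [hstress', hflow] with x h1 h2
    have h3 : 0 ≤ inner ℝ (s.ept t x) (s.stress t x) := by
      rw [h1, h2]
      exact inner_yosida_self_nonneg hlam k _
    refine ⟨trunc_nonneg hL.le h3, ?_⟩
    rw [← h1]
    exact trunc_le_self hL.le h3

end Approx

/-! ### Integration in time -/

theorem intervalIntegrable_of_timeMeasure {T τ : ℝ} {n : ℝ → ℝ} (hn : Integrable n (timeMeasure T))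
    (hτ : τ ∈ Icc 0 T) : IntervalIntegrable n volume 0 τ := by
  rw [intervalIntegrable_iff_integrableOn_Ioo_of_le hτ.1]
  exact hn.mono_measure (Measure.restrict_mono (Ioo_subset_Ioo le_rfl hτ.2) le_rfl)

theorem intervalIntegral_eq_integral_timeMeasure {T : ℝ} (hT : 0 ≤ T) (n : ℝ → ℝ) :
    ∫ t in (0 : ℝ)..T, n t = ∫ t, n t ∂timeMeasure T := by
  rw [intervalIntegral.integral_of_le hT, integral_Ioc_eq_integral_Ioo]

theorem intervalIntegral_mono_of_ae_timeMeasure {T τ : ℝ} {n m : ℝ → ℝ}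
    (hn : Integrable n (timeMeasure T)) (hm : Integrable m (timeMeasure T))
    (h : ∀ᵐ t ∂timeMeasure T, n t ≤ m t) (hτ : τ ∈ Icc 0 T) :
    ∫ t in (0 : ℝ)..τ, n t ≤ ∫ t in (0 : ℝ)..τ, m t := by
  have hle : timeMeasure τ ≤ timeMeasure T :=
    Measure.restrict_mono (Ioo_subset_Ioo le_rfl hτ.2) le_rfl
  rw [intervalIntegral_eq_integral_timeMeasure hτ.1, intervalIntegral_eq_integral_timeMeasure hτ.1]
  exact integral_mono_ae (hn.mono_measure hle) (hm.mono_measure hle) (ae_mono hle h)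

theorem intervalIntegral_le_of_nonneg {T τ : ℝ} {n : ℝ → ℝ} (hn : Integrable n (timeMeasure T))
    (h : ∀ t, 0 ≤ n t) (hτ : τ ∈ Icc 0 T) :
    ∫ t in (0 : ℝ)..τ, n t ≤ ∫ t in (0 : ℝ)..T, n t :=
  intervalIntegral.integral_mono_interval le_rfl hτ.1 hτ.2 (Eventually.of_forall h)
    (intervalIntegrable_of_timeMeasure hn ⟨hτ.1.trans hτ.2, le_rfl⟩)

/-- Here `nA` and `nθ` are the rates of the elastic energy and of `Z = ∫ √(1 + θ²)`, `q` is the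
dissipation and `g` collects the data. Grönwall's inequality, used while discarding `q ≥ 0`, bounds
`∫ Z`; the same inequality at time `T` then bounds `∫ q`. -/
theorem integral_dissipation_le_of_ae_le {T : ℝ} (hT : 0 ≤ T) {nA nθ q g Z : ℝ → ℝ} {E₀ Z₀ κ : ℝ}
    (hκ : 0 ≤ κ) (hnA : Integrable nA (timeMeasure T)) (hnθ : Integrable nθ (timeMeasure T))
    (hq : Integrable q (timeMeasure T)) (hg : Integrable g (timeMeasure T)) (hq0 : ∀ t, 0 ≤ q t)
    (hg0 : ∀ t, 0 ≤ g t) (hZ0 : ∀ t, 0 ≤ Z t)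
    (hA : ∀ τ ∈ Icc 0 T, -E₀ ≤ ∫ t in (0 : ℝ)..τ, nA t)
    (hθ : ∀ τ ∈ Icc 0 T, ∫ t in (0 : ℝ)..τ, nθ t = Z τ - Z₀)
    (h : ∀ᵐ t ∂timeMeasure T, nA t + nθ t + 1 / 2 * q t ≤ g t + κ * Z t) :
    ∫ t in (0 : ℝ)..T, q t ≤ 2 * ((E₀ + Z₀ + ∫ t in (0 : ℝ)..T, g t) +
      κ * gronwallBound 0 κ (E₀ + Z₀ + ∫ t in (0 : ℝ)..T, g t) T) := by
  have hTT : T ∈ Icc 0 T := ⟨hT, le_rfl⟩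
  have hZc : ContinuousOn Z (Icc 0 T) := by
    have := continuousOn_add_primitive (intervalIntegrable_of_timeMeasure hnθ hTT) Z₀
    rw [uIcc_of_le hT] at this
    refine this.congr fun t ht => ?_
    change Z t = Z₀ + ∫ s in (0 : ℝ)..t, nθ s
    rw [hθ t ht]
    ring
  have hZi : Integrable Z (timeMeasure T) :=
    hZc.integrableOn_Icc.mono_set Ioo_subset_Icc_self
  have key : ∀ τ ∈ Icc 0 T, Z τ + 1 / 2 * ∫ t in (0 : ℝ)..τ, q t ≤
      (E₀ + Z₀ + ∫ t in (0 : ℝ)..T, g t) + κ * ∫ t in (0 : ℝ)..τ, Z t := by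
    intro τ hτ
    have h1 := intervalIntegral_mono_of_ae_timeMeasure (n := fun t => nA t + nθ t + 1 / 2 * q t)
      (m := fun t => g t + κ * Z t) ((hnA.add hnθ).add (hq.const_mul _))
      (hg.add (hZi.const_mul _)) h hτ
    have iA := intervalIntegrable_of_timeMeasure hnA hτ
    have iθ := intervalIntegrable_of_timeMeasure hnθ hτ
    have iq := intervalIntegrable_of_timeMeasure hq hτ
    have ig := intervalIntegrable_of_timeMeasure hg hτ
    have iZ := intervalIntegrable_of_timeMeasure hZi hτ
    rw [intervalIntegral.integral_add (iA.add iθ) (iq.const_mul _),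
      intervalIntegral.integral_add iA iθ, intervalIntegral.integral_add ig (iZ.const_mul _),
      intervalIntegral.integral_const_mul, intervalIntegral.integral_const_mul, hθ τ hτ] at h1
    linarith [hA τ hτ, intervalIntegral_le_of_nonneg hg hg0 hτ]
  have hgr := integral_le_gronwallBound hT hZc (fun t _ => hZ0 t)
    (B := E₀ + Z₀ + ∫ t in (0 : ℝ)..T, g t) (K := κ) fun τ hτ => by
      have h1 := key τ hτ
      have h2 : 0 ≤ ∫ t in (0 : ℝ)..τ, q t := intervalIntegral.integral_nonneg hτ.1 fun t _ => hq0 t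
      linarith
  have h1 := key T hTT
  have h2 := mul_le_mul_of_nonneg_left hgr hκ
  linarith [hZ0 T]

section Approx

variable {Ω : TopologicalSpace.Opens R3} {T k : ℝ} {D : Sym3 →ₗ[ℝ] Sym3} {f : ℝ → ℝ}
  {F : ℝ → R3 → R3} {u₀ : R3 → R3} {gradU₀ : R3 → Mat3} {ep₀ : R3 → Sym3} {θ₀ : R3 → ℝ}
  {θtil : ℝ → R3 → ℝ} {lam : ℝ} {s : Fields}

theorem IsApproxSolution.strainRate_memL2
    (h : IsApproxSolution Ω T D k f F u₀ gradU₀ ep₀ θ₀ θtil lam s) :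
    MemL2L2 (spaceMeasure Ω) T (fun t x => symPart (s.gradUt t x)) :=
  h.gradU_time.deriv_memL2.clm symPartL

/-- A bound on the viscous dissipation which does not depend on the approximation. -/
theorem exists_dissipation_bound (hΩ : Bornology.IsBounded (Ω : Set R3)) (hT : 0 < T)
    (hDsymm : D.IsSymmetric) (hDpos : ∀ A : Sym3, A ≠ 0 → 0 < inner ℝ (D A) A)
    (hf : Continuous f)
    (hf_growth : ∃ a M α : ℝ, 0 ≤ a ∧ 0 ≤ M ∧ α ∈ Ioo (1 / 2 : ℝ) (5 / 6) ∧
      ∀ r : ℝ, |f r| ≤ a + M * |r| ^ α)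
    (hf_neg : ∃ C : ℝ, 0 < C ∧ ∀ r : ℝ, r < 0 → |f r| ≤ C * (1 + |r|) ^ (1 / 2 : ℝ))
    (hF : MemL2L2 (spaceMeasure Ω) T F) (hgradU₀ : MemLp gradU₀ 2 (spaceMeasure Ω))
    (hep₀ : MemLp ep₀ 2 (spaceMeasure Ω)) (hθ₀ : MemLp θ₀ 2 (spaceMeasure Ω))
    (hθtil : MemL2L2 (spaceMeasure Ω) T θtil) :
    ∃ C : ℝ, ∀ lam : ℝ, 0 < lam → ∀ s : Fields,
      IsApproxSolution Ω T D k f F u₀ gradU₀ ep₀ θ₀ θtil lam s →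
      ∫ p, inner ℝ (D (symPart (s.gradUt p.1 p.2))) (symPart (s.gradUt p.1 p.2))
        ∂(timeMeasure T).prod (spaceMeasure Ω) ≤ C := by
  have := isFiniteMeasure_spaceMeasure hΩ
  obtain ⟨c, hc, hD⟩ := exists_coercive D hDpos
  obtain ⟨K, hK0, hK⟩ := exists_thermal_bound hf_growth hf_neg
  obtain ⟨R, hR, hΩR⟩ := hΩ.subset_closedBall_lt 0 0
  set Dc : Sym3 →L[ℝ] Sym3 := D.toContinuousLinearMap with hDc
  set A₀ : R3 → Sym3 := fun x => symPart (gradU₀ x) - ep₀ x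
  have hA₀ : MemLp A₀ 2 (spaceMeasure Ω) := (symPartL.comp_memLp' hgradU₀).sub hep₀
  have iF := integrable_norm_sq_of_memLp hF
  have iθtil := integrable_norm_sq_of_memLp hθtil
  simp only [Real.norm_eq_abs, sq_abs] at iθtil
  set g : ℝ → ℝ := fun t => 4 * R ^ 2 / c * ∫ x, ‖F t x‖ ^ 2 ∂spaceMeasure Ω +
    3 * K / c * ∫ x, θtil t x ^ 2 ∂spaceMeasure Ω
  have hg : Integrable g (timeMeasure T) :=
    (iF.integral_prod_left.const_mul _).add (iθtil.integral_prod_left.const_mul _)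
  have hg0 : ∀ t, 0 ≤ g t := fun t => by
    have h1 : 0 ≤ ∫ x, ‖F t x‖ ^ 2 ∂spaceMeasure Ω := integral_nonneg fun x => sq_nonneg _
    have h2 : 0 ≤ ∫ x, θtil t x ^ 2 ∂spaceMeasure Ω := integral_nonneg fun x => sq_nonneg _
    positivity
  set B : ℝ := ∫ x, inner ℝ (D (A₀ x)) (A₀ x) / 2 ∂spaceMeasure Ω +
    ∫ x, smoothAbs (θ₀ x) ∂spaceMeasure Ω + ∫ t in (0 : ℝ)..T, g t
  -- `B` is the initial elastic energy, plus the initial thermal energy, plus the data. The rate `6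
  -- * K / c` is `3 * K / c` from the energy inequality, doubled by `1 + |θ| ≤ 2 √(1 + θ²)`.
  refine ⟨2 * (B + 6 * K / c * gronwallBound 0 (6 * K / c) B T), fun lam hlam s h => ?_⟩
  have hq := integrable_inner_of_memLp (Dc.comp_memLp' h.strainRate_memL2) h.strainRate_memL2
  have hA := h.strain_time
  have hnA := integrable_inner_of_memLp (Dc.comp_memLp' hA.memL2) hA.deriv_memL2
  have hη : AEStronglyMeasurable (fun p : ℝ × R3 => smoothSign (s.θ p.1 p.2))
      ((timeMeasure T).prod (spaceMeasure Ω)) :=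
    continuous_smoothSign.comp_aestronglyMeasurable h.θ_time.memL2.aestronglyMeasurable
  have hnθ : Integrable (fun p : ℝ × R3 => s.θt p.1 p.2 * smoothSign (s.θ p.1 p.2))
      ((timeMeasure T).prod (spaceMeasure Ω)) :=
    h.θ_time.deriv_memL2.integrable.mul_bdd hη (Eventually.of_forall fun p => abs_smoothSign_le _)
  have hZθ : ∀ {w : R3 → ℝ}, MemLp w 2 (spaceMeasure Ω) →
      Integrable (fun x => smoothAbs (w x)) (spaceMeasure Ω) := by
    intro w hw
    refine ((integrable_const (1 : ℝ)).add (hw.integrable (by norm_num)).abs).mono'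
      (continuous_smoothAbs.comp_aestronglyMeasurable hw.aestronglyMeasurable)
      (Eventually.of_forall fun x => ?_)
    rw [Real.norm_of_nonneg (smoothAbs_pos _).le]
    exact smoothAbs_le _
  -- the chain rule for the elastic energy
  have hE : ∀ τ ∈ Icc 0 T, -∫ x, inner ℝ (D (A₀ x)) (A₀ x) / 2 ∂spaceMeasure Ω ≤
      ∫ t in (0 : ℝ)..τ, ∫ x, inner ℝ (D (s.strain t x)) (s.strainDeriv t x) ∂spaceMeasure Ω := by
    intro τ hτ
    have h1 := hA.integral_chain_rule hT (Φ := fun A => inner ℝ (Dc A) A / 2)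
      (Φ' := fun A => innerSL ℝ (Dc A)) (C := ‖Dc‖) (fun A => hasFDerivAt_half_inner hDsymm A)
      (fun A => by
        rw [innerSL_apply_norm]
        refine (Dc.le_opNorm A).trans ?_
        gcongr
        linarith) hnA
      ((integrable_inner_of_memLp (Dc.comp_memLp' hA₀) hA₀).div_const 2) hτ
    have h2 := h1.2
    simp only [innerSL_apply_apply] at h2
    have h3 : 0 ≤ ∫ x, inner ℝ (Dc (primitive A₀ s.strainDeriv τ x))
        (primitive A₀ s.strainDeriv τ x) / 2 ∂spaceMeasure Ω :=
      integral_nonneg fun x => div_nonneg ((by positivity : (0 : ℝ) ≤ c * _ ^ 2).trans (hD _))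
        zero_le_two
    change _ ≤ ∫ t in (0 : ℝ)..τ, ∫ x, inner ℝ (Dc (s.strain t x)) (s.strainDeriv t x)
      ∂spaceMeasure Ω
    rw [h2]
    change -∫ x, inner ℝ (Dc (A₀ x)) (A₀ x) / 2 ∂spaceMeasure Ω ≤ _
    linarith
  -- the chain rule for the temperature
  have hZ : ∀ τ ∈ Icc 0 T,
      ∫ t in (0 : ℝ)..τ, ∫ x, s.θt t x * smoothSign (s.θ t x) ∂spaceMeasure Ω =
      ∫ x, smoothAbs (primitive θ₀ s.θt τ x) ∂spaceMeasure Ω -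
        ∫ x, smoothAbs (θ₀ x) ∂spaceMeasure Ω := by
    intro τ hτ
    have h1 := h.θ_time.integral_chain_rule hT (Φ := smoothAbs)
      (Φ' := fun r => ContinuousLinearMap.toSpanSingleton ℝ (smoothSign r)) (C := 1)
      (fun r => (hasDerivAt_smoothAbs r).hasFDerivAt)
      (fun r => by
        rw [ContinuousLinearMap.norm_toSpanSingleton, Real.norm_eq_abs]
        linarith [abs_smoothSign_le r, norm_nonneg r])
      (by simpa using hnθ) (hZθ hθ₀) hτ
    simpa using h1.2
  have hineq : ∀ᵐ t ∂timeMeasure T,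
      ∫ x, inner ℝ (D (s.strain t x)) (s.strainDeriv t x) ∂spaceMeasure Ω +
        ∫ x, s.θt t x * smoothSign (s.θ t x) ∂spaceMeasure Ω +
        1 / 2 * ∫ x, inner ℝ (D (symPart (s.gradUt t x))) (symPart (s.gradUt t x)) ∂spaceMeasure Ω ≤
      g t + 6 * K / c * ∫ x, smoothAbs (primitive θ₀ s.θt t x) ∂spaceMeasure Ω := by
    -- Grönwall's argument needs a continuous function of time, so `θ` is replaced by its absolutely
    -- continuous representative, with which it agrees for a.e. `t`.
    filter_upwards [h.ae_energy_inequality hΩ hR hΩR hc hD hf hK hlam hF hθtil,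
      h.θ_time.ae_eq_primitive_prod hT hθ₀.aestronglyMeasurable, h.θ_time.memL2.ae_memLp,
      hθtil.ae_memLp] with t ht hprim hθt hθtilt
    refine ht.trans ?_
    have h1 : ∫ x, (1 + |s.θ t x| + θtil t x ^ 2) ∂spaceMeasure Ω ≤
        2 * ∫ x, smoothAbs (primitive θ₀ s.θt t x) ∂spaceMeasure Ω +
          ∫ x, θtil t x ^ 2 ∂spaceMeasure Ω := by
      have h2 : ∫ x, smoothAbs (primitive θ₀ s.θt t x) ∂spaceMeasure Ω =
          ∫ x, smoothAbs (s.θ t x) ∂spaceMeasure Ω := by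
        refine integral_congr_ae ?_
        filter_upwards [hprim] with x hx
        rw [hx]
      rw [h2, ← integral_const_mul, ← integral_add ((hZθ hθt).const_mul 2) hθtilt.integrable_sq]
      refine integral_mono
        (((integrable_const 1).add (hθt.integrable (by norm_num)).abs).add hθtilt.integrable_sq)
        (((hZθ hθt).const_mul 2).add hθtilt.integrable_sq) fun x => ?_
      have := one_le_smoothAbs (s.θ t x)
      have := abs_le_smoothAbs (s.θ t x)
      linarith
    have h3 : 0 ≤ 3 * K / c := by positivity
    have h4 := mul_le_mul_of_nonneg_left h1 h3
    simp only [g]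
    refine (add_le_add_right h4 _).trans_eq ?_
    ring
  have hfin := integral_dissipation_le_of_ae_le hT.le (by positivity : 0 ≤ 6 * K / c)
    hnA.integral_prod_left hnθ.integral_prod_left hq.integral_prod_left hg
    (fun t => integral_nonneg fun x => (by positivity : (0 : ℝ) ≤ c * _ ^ 2).trans (hD _)) hg0
    (fun t => integral_nonneg fun x => (smoothAbs_pos _).le) hE hZ hineq
  rw [intervalIntegral_eq_integral_timeMeasure hT.le] at hfin
  exact (integral_prod _ hq).trans_le hfin

/-- With `ε(u_t) = A_t + ε^p_t` and `D` symmetric, the right integrand is `D A_t : A_t + 2 ε^p_t : D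
A_t + D ε^p_t : ε^p_t`. The last term is nonnegative, and the integral of the middle one is twice
the total increase of the Moreau envelope of the stress. -/
theorem IsApproxSolution.integral_stressDeriv_le (hΩ : Bornology.IsBounded (Ω : Set R3))
    (hT : 0 < T) (hk : 0 < k) (hDsymm : D.IsSymmetric) {c : ℝ} (hc : 0 < c)
    (hD : ∀ A, c * ‖A‖ ^ 2 ≤ inner ℝ (D A) A) (hlam : 0 < lam)
    (hyield : ∀ᵐ x ∂spaceMeasure Ω, ‖dev (D (symPart (gradU₀ x) - ep₀ x))‖ ≤ k)
    (h : IsApproxSolution Ω T D k f F u₀ gradU₀ ep₀ θ₀ θtil lam s) :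
    ∫ p, inner ℝ (D (s.strainDeriv p.1 p.2)) (s.strainDeriv p.1 p.2)
        ∂(timeMeasure T).prod (spaceMeasure Ω) ≤
      ∫ p, inner ℝ (D (symPart (s.gradUt p.1 p.2))) (symPart (s.gradUt p.1 p.2))
        ∂(timeMeasure T).prod (spaceMeasure Ω) := by
  have := isFiniteMeasure_spaceMeasure hΩ
  set Dc : Sym3 →L[ℝ] Sym3 := D.toContinuousLinearMap with hDc
  have hA := h.strain_time
  have hDA : MemL2L2 (spaceMeasure Ω) T fun t x => Dc (s.strainDeriv t x) := hA.deriv_memL2.clm Dc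
  have iY : Integrable (fun p : ℝ × R3 => (inner ℝ (s.ept p.1 p.2) (Dc (s.strainDeriv p.1 p.2)) : ℝ))
      ((timeMeasure T).prod (spaceMeasure Ω)) :=
    integrable_inner_of_memLp h.ep_time.deriv_memL2 hDA
  have heq : (fun p : ℝ × R3 => (inner ℝ (s.ept p.1 p.2) (Dc (s.strainDeriv p.1 p.2)) : ℝ))
      =ᵐ[(timeMeasure T).prod (spaceMeasure Ω)] fun p =>
        (innerSL ℝ (yosida lam k (Dc (s.strain p.1 p.2))) ∘L Dc) (s.strainDeriv p.1 p.2) := by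
    filter_upwards [h.ae_ept_eq] with p hp
    rw [hp]
    rfl
  -- The yield condition on the initial data enters here: without it the initial envelope could be
  -- of order `1 / lam`.
  have hM₀ : (fun x => moreau lam k (Dc (symPart (gradU₀ x) - ep₀ x))) =ᵐ[spaceMeasure Ω]
      fun _ => 0 := by
    filter_upwards [hyield] with x hx
    exact moreau_eq_zero lam hx
  have hTT : T ∈ Icc 0 T := ⟨hT.le, le_rfl⟩
  have h1 := hA.integral_chain_rule hT (Φ := fun A => moreau lam k (Dc A))
    (Φ' := fun A => innerSL ℝ (yosida lam k (Dc A)) ∘L Dc)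
    (C := 1 / (2 * lam) * ‖Dc‖ * ‖Dc‖)
    (fun A => (hasFDerivAt_moreau hlam hk (Dc A)).comp A Dc.hasFDerivAt)
    (fun A => by
      refine (ContinuousLinearMap.opNorm_comp_le _ _).trans ?_
      rw [innerSL_apply_norm]
      calc ‖yosida lam k (Dc A)‖ * ‖Dc‖ ≤ 1 / (2 * lam) * (‖Dc‖ * ‖A‖) * ‖Dc‖ := by
            gcongr
            refine (norm_yosida_le hlam hk _).trans ?_
            gcongr
            exact Dc.le_opNorm A
        _ = 1 / (2 * lam) * ‖Dc‖ * ‖Dc‖ * ‖A‖ := by ring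
        _ ≤ _ := by gcongr; linarith)
    (iY.congr heq) ((integrable_zero _ _ _).congr hM₀.symm) hTT
  have h2 : 0 ≤ ∫ p, inner ℝ (s.ept p.1 p.2) (Dc (s.strainDeriv p.1 p.2))
      ∂(timeMeasure T).prod (spaceMeasure Ω) := by
    rw [integral_congr_ae heq, integral_prod _ (iY.congr heq),
      ← intervalIntegral_eq_integral_timeMeasure hT.le, h1.2, integral_congr_ae hM₀]
    simp only [integral_zero, sub_zero]
    exact integral_nonneg fun x => moreau_nonneg hlam k _
  have iε : Integrable (fun p : ℝ × R3 =>
      (inner ℝ (Dc (symPart (s.gradUt p.1 p.2))) (symPart (s.gradUt p.1 p.2)) : ℝ))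
      ((timeMeasure T).prod (spaceMeasure Ω)) :=
    integrable_inner_of_memLp (Dc.comp_memLp' h.strainRate_memL2) h.strainRate_memL2
  have iA : Integrable (fun p : ℝ × R3 =>
      (inner ℝ (Dc (s.strainDeriv p.1 p.2)) (s.strainDeriv p.1 p.2) : ℝ))
      ((timeMeasure T).prod (spaceMeasure Ω)) := integrable_inner_of_memLp hDA hA.deriv_memL2
  have h3 : ∫ p, inner ℝ (Dc (s.strainDeriv p.1 p.2)) (s.strainDeriv p.1 p.2)
        ∂(timeMeasure T).prod (spaceMeasure Ω) +
      2 * ∫ p, inner ℝ (s.ept p.1 p.2) (Dc (s.strainDeriv p.1 p.2))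
        ∂(timeMeasure T).prod (spaceMeasure Ω) ≤
      ∫ p, inner ℝ (Dc (symPart (s.gradUt p.1 p.2))) (symPart (s.gradUt p.1 p.2))
        ∂(timeMeasure T).prod (spaceMeasure Ω) := by
    rw [← integral_const_mul, ← integral_add iA (iY.const_mul 2)]
    refine integral_mono (iA.add (iY.const_mul 2)) iε fun p => ?_
    have h4 : symPart (s.gradUt p.1 p.2) = s.strainDeriv p.1 p.2 + s.ept p.1 p.2 :=
      (sub_add_cancel _ _).symm
    have h5 : inner ℝ (Dc (s.ept p.1 p.2)) (s.strainDeriv p.1 p.2) =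
        inner ℝ (s.ept p.1 p.2) (Dc (s.strainDeriv p.1 p.2)) := hDsymm _ _
    have h6 : 0 ≤ inner ℝ (Dc (s.ept p.1 p.2)) (s.ept p.1 p.2) :=
      (by positivity : (0 : ℝ) ≤ c * ‖s.ept p.1 p.2‖ ^ 2).trans (hD _)
    simp only
    rw [h4, map_add, inner_add_left, inner_add_right, inner_add_right, h5,
      real_inner_comm (s.ept p.1 p.2) (Dc (s.strainDeriv p.1 p.2))]
    linarith
  exact (le_add_of_nonneg_right (mul_nonneg zero_le_two h2)).trans h3

/-- The time derivative of the stress is controlled by the dissipation. -/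
theorem IsApproxSolution.normL2L2_stressDeriv_le (hΩ : Bornology.IsBounded (Ω : Set R3))
    {c : ℝ} (hc : 0 < c)
    (hD : ∀ A, c * ‖A‖ ^ 2 ≤ inner ℝ (D A) A)
    (h : IsApproxSolution Ω T D k f F u₀ gradU₀ ep₀ θ₀ θtil lam s) {B : ℝ}
    (hB : ∫ p, inner ℝ (D (s.strainDeriv p.1 p.2)) (s.strainDeriv p.1 p.2)
      ∂(timeMeasure T).prod (spaceMeasure Ω) ≤ B) :
    normL2L2 (spaceMeasure Ω) T (fun t x => D (s.strainDeriv t x)) ≤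
      ENNReal.ofReal ((‖D.toContinuousLinearMap‖ ^ 2 / c * B) ^ (2⁻¹ : ℝ)) := by
  have := isFiniteMeasure_spaceMeasure hΩ
  set Dc : Sym3 →L[ℝ] Sym3 := D.toContinuousLinearMap with hDc
  have hA := h.strain_time.deriv_memL2
  have hDA : MemL2L2 (spaceMeasure Ω) T fun t x => Dc (s.strainDeriv t x) := hA.clm Dc
  have iA : Integrable (fun p : ℝ × R3 =>
      (inner ℝ (D (s.strainDeriv p.1 p.2)) (s.strainDeriv p.1 p.2) : ℝ))
      ((timeMeasure T).prod (spaceMeasure Ω)) := integrable_inner_of_memLp hDA hA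
  have h1 : ∫ p, ‖Dc (s.strainDeriv p.1 p.2)‖ ^ 2 ∂(timeMeasure T).prod (spaceMeasure Ω) ≤
      ‖Dc‖ ^ 2 / c * B := by
    refine le_trans ?_ (mul_le_mul_of_nonneg_left hB (by positivity))
    rw [← integral_const_mul]
    refine integral_mono (integrable_norm_sq_of_memLp hDA) (iA.const_mul _) fun p => ?_
    calc ‖Dc (s.strainDeriv p.1 p.2)‖ ^ 2 ≤ (‖Dc‖ * ‖s.strainDeriv p.1 p.2‖) ^ 2 := by
          gcongr
          exact Dc.le_opNorm _
      _ = ‖Dc‖ ^ 2 / c * (c * ‖s.strainDeriv p.1 p.2‖ ^ 2) := by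
          field_simp
      _ ≤ _ := by
          gcongr
          exact hD _
  have h2 : normL2L2 (spaceMeasure Ω) T (fun t x => Dc (s.strainDeriv t x)) =
      ENNReal.ofReal ((∫ p, ‖Dc (s.strainDeriv p.1 p.2)‖ ^ 2
        ∂(timeMeasure T).prod (spaceMeasure Ω)) ^ (2⁻¹ : ℝ)) := by
    rw [normL2L2, MemLp.eLpNorm_eq_integral_rpow_norm two_ne_zero ENNReal.ofNat_ne_top hDA]
    simp
  refine h2.trans_le (ENNReal.ofReal_le_ofReal (Real.rpow_le_rpow ?_ h1 (by norm_num)))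
  exact integral_nonneg fun p => sq_nonneg _

end Approx

end ThermoPlast

end

/-! ### The uniform bound on the stress rate -/

theorem theorem4p2
    (Ω : TopologicalSpace.Opens ThermoPlast.R3) (hΩ : ThermoPlast.IsBoundedC2Domain Ω)
    (T : ℝ) (hT : 0 < T) (k : ℝ) (hk : 0 < k)
    (D : ThermoPlast.Sym3 →ₗ[ℝ] ThermoPlast.Sym3)
    (hDsymm : D.IsSymmetric) (hDpos : ∀ A : ThermoPlast.Sym3, A ≠ 0 → 0 < inner ℝ (D A) A)
    (f : ℝ → ℝ) (hf : Continuous f)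
    (hf_growth : ∃ a M α : ℝ, 0 ≤ a ∧ 0 ≤ M ∧ α ∈ Set.Ioo (1 / 2 : ℝ) (5 / 6) ∧
      ∀ r : ℝ, |f r| ≤ a + M * |r| ^ α)
    (hf_neg : ∃ C : ℝ, 0 < C ∧ ∀ r : ℝ, r < 0 → |f r| ≤ C * (1 + |r|) ^ (1 / 2 : ℝ))
    (F : ℝ → ThermoPlast.R3 → ThermoPlast.R3)
    (hF : ThermoPlast.MemL2L2 (ThermoPlast.spaceMeasure Ω) T F)
    (g : ℝ → ThermoPlast.R3 → ℝ)
    (hg : ∃ g' : ℝ → ThermoPlast.R3 → ℝ,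
      ThermoPlast.InH1Time (ThermoPlast.surfaceMeasure Ω) T g g')
    (u₀ : ThermoPlast.R3 → ThermoPlast.R3) (gradU₀ : ThermoPlast.R3 → ThermoPlast.Mat3)
    (hu₀ : ThermoPlast.InH1Vec Ω u₀ gradU₀)
    (ep₀ : ThermoPlast.R3 → ThermoPlast.Sym3)
    (hep₀ : MeasureTheory.MemLp ep₀ 2 (ThermoPlast.spaceMeasure Ω))
    (θ₀ : ThermoPlast.R3 → ℝ)
    (hθ₀ : ∃ G : ThermoPlast.R3 → ThermoPlast.R3, ThermoPlast.InH1 Ω θ₀ G)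
    (hyield : ∀ᵐ x ∂ThermoPlast.spaceMeasure Ω,
      ‖ThermoPlast.dev (D (ThermoPlast.symPart (gradU₀ x) - ep₀ x))‖ ≤ k)
    (θtil : ℝ → ThermoPlast.R3 → ℝ)
    (hθtil : ThermoPlast.SolvesBoundaryProblem Ω T g θtil) :
    ∃ C : ℝ, ∀ lam : ℝ, 0 < lam → ∀ s : ThermoPlast.Fields,
      ThermoPlast.IsApproxSolution Ω T D k f F u₀ gradU₀ ep₀ θ₀ θtil lam s →
      ∃ stress' : ℝ → ThermoPlast.R3 → ThermoPlast.Sym3,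
        ThermoPlast.HasWeakTimeDeriv (ThermoPlast.spaceMeasure Ω) T s.stress stress' ∧
        ThermoPlast.MemL2L2 (ThermoPlast.spaceMeasure Ω) T stress' ∧
        ThermoPlast.normL2L2 (ThermoPlast.spaceMeasure Ω) T stress' ≤ ENNReal.ofReal C := by
  have := ThermoPlast.isFiniteMeasure_spaceMeasure hΩ.bounded
  obtain ⟨G₀, hG₀⟩ := hθ₀
  obtain ⟨θtil', G, hθtil', -⟩ := hθtil
  obtain ⟨B, hB⟩ := ThermoPlast.exists_dissipation_bound (k := k) (u₀ := u₀) hΩ.bounded hT hDsymm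
    hDpos hf hf_growth hf_neg hF hu₀.grad_memLp hep₀ hG₀.memLp hθtil'.memL2
  obtain ⟨c, hc, hD⟩ := ThermoPlast.exists_coercive D hDpos
  -- The factor `‖D‖² / c` comes from `|D A_t|² ≤ ‖D‖² |A_t|² ≤ (‖D‖² / c) D A_t : A_t`. Neither `c`
  -- nor `B` depends on `lam` or on the solution.
  refine ⟨(‖D.toContinuousLinearMap‖ ^ 2 / c * B) ^ (2⁻¹ : ℝ), fun lam hlam s h =>
    ⟨fun t x => D (s.strainDeriv t x), ?_, ?_, ?_⟩⟩
  · exact (h.strain_time.clm D.toContinuousLinearMap).weakDeriv.hasWeakTimeDeriv.congr_left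
      h.stress_eq
  · exact h.strain_time.deriv_memL2.clm D.toContinuousLinearMap
  · exact h.normL2L2_stressDeriv_le hΩ.bounded hc hD
      ((h.integral_stressDeriv_le hΩ.bounded hT hk hDsymm hc hD hlam hyield).trans (hB lam hlam s h))
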